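/- Let $K$ be a field. A positively graded $K$-algebra is a nonzero commutative graded $K$-algebra $A=\bigoplus_{i\ge 0}A_i$ of the form $A=K[x_1,\dots,x_n]/Q$, where $\deg x_i=1$ and $Q$ is a homogeneous ideal; let $\mathfrak m=\bigoplus_{i>0}A_i$. Such an algebra $A$ is called Koszul if its residue class field $K=A/\mathfrak m$ has a linear graded $A$-free resolution, that is, if there are integers $r_i\ge 0$ and an exact sequence of graded $A$-modules and degree-preserving $A$-linear maps $$\cdots\to A(-2)^{r_2}\to A(-1)^{r_1}\to A^{r_0}\to K\to 0 .$$ Let $A$ and $B$ be positively graded $K$-algebras which are Koszul. Then the following hold. 1. The tensor product $A\otimes_K B$, graded by $(A\otimes_K B)_n=\bigoplus_{i+j=n}A_i\otimes_K B_j$, is a positively graded $K$-algebra and is Koszul. 2. The Segre product $A\star B=\bigoplus_{i\ge 0}A_i\otimes_K B_i\subseteq A\otimes_K B$ (the $(1,1)$-diagonal of the bigraded algebra $A\otimes_K B$), with $A_i\otimes_K B_i$ in degree $i$, is a positively graded $K$-algebra and is Koszul. 3. For every integer $d\ge 1$, the Veronese subring $A^{(d)}=\bigoplus_{i\ge 0}A_{id}\subseteq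 A$, with $A_{id}$ in degree $i$, is a positively graded $K$-algebra and is Koszul. -/

import Mathlib

open scoped TensorProduct

noncomputable section

namespace KoszulAlg

section Basic

variable {K A : Type*} [Field K] [CommRing A] [Algebra K A]

/-- `A = ⨁ i, 𝒜 i` is a positively (standard) graded `K`-algebra: it is, as a graded algebra,
a nonzero quotient `K[x₁, …, xₙ] / Q` with `deg xᵢ = 1` and `Q` a homogeneous ideal. The
quotient map is `φ`. As the images `𝒜 i` of the homogeneous components of the polynomial ring
are required to form a direct sum, the kernel `Q` of `φ` is homogeneous. -/
structure IsStandardGraded (𝒜 : ℕ → Submodule K A) : Prop where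
  nontrivial : Nontrivial A
  isInternal : DirectSum.IsInternal 𝒜
  presentation : ∃ (n : ℕ) (φ : MvPolynomial (Fin n) K →ₐ[K] A), Function.Surjective φ ∧
    ∀ i, 𝒜 i = (MvPolynomial.homogeneousSubmodule (Fin n) K i).map φ.toLinearMap

/-- The graded maximal ideal, generated by all homogeneous elements of positive degree. -/
def gradedMaximalIdeal (𝒜 : ℕ → Submodule K A) : Ideal A :=
  Ideal.span {x | ∃ i, 0 < i ∧ x ∈ 𝒜 i}

/-- The residue class field of a positively graded algebra, as an `A`-module. -/
abbrev ResidueField (𝒜 : ℕ → Submodule K A) : Type _ :=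
  A ⧸ gradedMaximalIdeal 𝒜

/-- A (`0`-)linear graded `A`-free resolution of the residue class field,
`⋯ ⟶ A(-2) ^ r₂ ⟶ A(-1) ^ r₁ ⟶ A ^ r₀ ⟶ K ⟶ 0`.
The component of degree `n + i` of `A(-i) ^ rᵢ` consists of the vectors with all entries in `𝒜 n`
(and the components of degree `< i` vanish), so that the `i`-th differential, from
`A(-(i + 1)) ^ rᵢ₊₁` to `A(-i) ^ rᵢ`, preserves degrees iff it takes vectors with entries in `𝒜 n`
to vectors with entries in `𝒜 (n + 1)`.
The augmentation preserves degrees automatically: the residue class field is annihilated by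
the elements of positive degree. -/
structure LinearFreeResolution (𝒜 : ℕ → Submodule K A) where
  rank : ℕ → ℕ
  d : ∀ i, (Fin (rank (i + 1)) → A) →ₗ[A] (Fin (rank i) → A)
  ε : (Fin (rank 0) → A) →ₗ[A] ResidueField 𝒜
  d_degree : ∀ (i n : ℕ) (v : Fin (rank (i + 1)) → A), (∀ j, v j ∈ 𝒜 n) →
    ∀ k, d i v k ∈ 𝒜 (n + 1)
  ε_surjective : Function.Surjective ε
  exact_zero : Function.Exact (d 0) ε
  exact_succ : ∀ i, Function.Exact (d (i + 1)) (d i)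

/-- A positively graded `K`-algebra is Koszul if its residue class field has a linear
`A`-free resolution. -/
structure IsKoszul (𝒜 : ℕ → Submodule K A) : Prop where
  isStandardGraded : IsStandardGraded 𝒜
  linear : Nonempty (LinearFreeResolution 𝒜)

/-- The `ℕ`-grading `Rₙ = ⨁_{i + j = n} R_(i, j)` underlying a bigrading. -/
def totalGrading (ℛ : ℕ × ℕ → Submodule K A) (n : ℕ) : Submodule K A :=
  ⨆ (p : ℕ × ℕ) (_ : p.1 + p.2 = n), ℛ p

/-- The sum `∑ i, 𝒞 i` of a multiplicative family of subspaces, as a subalgebra. -/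
def sumSubalgebra (𝒞 : ℕ → Submodule K A) [SetLike.GradedMonoid 𝒞] : Subalgebra K A :=
  (⨆ i, 𝒞 i : Submodule K A).toSubalgebra
    (Submodule.mem_iSup_of_mem 0 (SetLike.GradedOne.one_mem))
    (fun x y hx hy => by
      have h : (⨆ i, 𝒞 i) * (⨆ i, 𝒞 i) ≤ ⨆ i, 𝒞 i := by
        rw [Submodule.iSup_mul]
        refine iSup_le fun i => ?_
        rw [Submodule.mul_iSup]
        refine iSup_le fun j => ?_
        rw [Submodule.mul_le]
        intro a ha b hb
        exact Submodule.mem_iSup_of_mem (i + j) (SetLike.GradedMul.mul_mem ha hb)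
      exact h (Submodule.mul_mem_mul hx hy))

/-- The family `𝒞`, viewed as a family of subspaces of the subalgebra `∑ i, 𝒞 i`. -/
def sumGrading (𝒞 : ℕ → Submodule K A) [SetLike.GradedMonoid 𝒞] (i : ℕ) :
    Submodule K (sumSubalgebra 𝒞) :=
  (𝒞 i).comap (sumSubalgebra 𝒞).val.toLinearMap

/-- The components `R_(ia, ib)` of the `(a, b)`-diagonal subalgebra of a bigraded algebra. -/
def diagonalComponent (ℛ : ℕ × ℕ → Submodule K A) (a b i : ℕ) : Submodule K A :=
  ℛ (i * a, i * b)

instance (ℛ : ℕ × ℕ → Submodule K A) [SetLike.GradedMonoid ℛ] (a b : ℕ) :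
    SetLike.GradedMonoid (diagonalComponent ℛ a b) where
  one_mem := by
    have h : (1 : A) ∈ ℛ (0, 0) := SetLike.GradedOne.one_mem
    simpa [diagonalComponent] using h
  mul_mem i j x y hx hy := by
    have h := SetLike.GradedMul.mul_mem (A := ℛ) hx hy
    simpa [diagonalComponent, add_mul] using h

/-- The components `A_(id)` of the `d`-th Veronese subring of a graded algebra. -/
def veroneseComponent (𝒜 : ℕ → Submodule K A) (d i : ℕ) : Submodule K A :=
  𝒜 (i * d)

instance (𝒜 : ℕ → Submodule K A) [SetLike.GradedMonoid 𝒜] (d : ℕ) :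
    SetLike.GradedMonoid (veroneseComponent 𝒜 d) where
  one_mem := by
    have h : (1 : A) ∈ 𝒜 0 := SetLike.GradedOne.one_mem
    simpa [veroneseComponent] using h
  mul_mem i j x y hx hy := by
    have h := SetLike.GradedMul.mul_mem (A := 𝒜) hx hy
    simpa [veroneseComponent, add_mul] using h

/-- The `d`-th Veronese subring `A^(d) = ⨁ i, A_(id)`, a subalgebra of `A`. -/
abbrev veronese (𝒜 : ℕ → Submodule K A) [SetLike.GradedMonoid 𝒜] (d : ℕ) : Subalgebra K A :=
  sumSubalgebra (veroneseComponent 𝒜 d)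

/-- The grading of the `d`-th Veronese subring, with `A_(id)` in degree `i`. -/
abbrev veroneseGrading (𝒜 : ℕ → Submodule K A) [SetLike.GradedMonoid 𝒜] (d : ℕ) :
    ℕ → Submodule K (veronese 𝒜 d) :=
  sumGrading (veroneseComponent 𝒜 d)

/-- The `(a, b)`-diagonal subalgebra `⨁ i, R_(ia, ib)` of a bigraded algebra. -/
abbrev diagonal (ℛ : ℕ × ℕ → Submodule K A) [SetLike.GradedMonoid ℛ] (a b : ℕ) :
    Subalgebra K A :=
  sumSubalgebra (diagonalComponent ℛ a b)

/-- The grading of the `(a, b)`-diagonal subalgebra, with `R_(ia, ib)` in degree `i`. -/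
abbrev diagonalGrading (ℛ : ℕ × ℕ → Submodule K A) [SetLike.GradedMonoid ℛ] (a b : ℕ) :
    ℕ → Submodule K (diagonal ℛ a b) :=
  sumGrading (diagonalComponent ℛ a b)

end Basic

section Tensor

variable {K A B : Type*} [Field K] [CommRing A] [Algebra K A] [CommRing B] [Algebra K B]

/-- The bigrading of `A ⊗ B`, with `Aᵢ ⊗ Bⱼ` (as a subspace of `A ⊗ B`) in degree `(i, j)`. -/
def tensorBigrading (𝒜 : ℕ → Submodule K A) (ℬ : ℕ → Submodule K B) (p : ℕ × ℕ) :
    Submodule K (A ⊗[K] B) :=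
  LinearMap.range (TensorProduct.map (𝒜 p.1).subtype (ℬ p.2).subtype)

instance (𝒜 : ℕ → Submodule K A) [SetLike.GradedMonoid 𝒜]
    (ℬ : ℕ → Submodule K B) [SetLike.GradedMonoid ℬ] :
    SetLike.GradedMonoid (tensorBigrading 𝒜 ℬ) where
  one_mem := ⟨(⟨1, SetLike.GradedOne.one_mem⟩ : 𝒜 0) ⊗ₜ (⟨1, SetLike.GradedOne.one_mem⟩ : ℬ 0),
    by simp [Algebra.TensorProduct.one_def]⟩
  mul_mem i j x y hx hy := by
    obtain ⟨x, rfl⟩ := hx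
    obtain ⟨y, rfl⟩ := hy
    induction x with
    | zero => simp
    | add x₁ x₂ h₁ h₂ => rw [map_add, add_mul]; exact add_mem h₁ h₂
    | tmul a b =>
      induction y with
      | zero => simp
      | add y₁ y₂ h₁ h₂ => rw [map_add, mul_add]; exact add_mem h₁ h₂
      | tmul a' b' =>
        exact ⟨(⟨a * a', SetLike.GradedMul.mul_mem a.2 a'.2⟩ : 𝒜 (i.1 + j.1)) ⊗ₜ
          (⟨b * b', SetLike.GradedMul.mul_mem b.2 b'.2⟩ : ℬ (i.2 + j.2)), by simp⟩

/-- The `ℕ`-grading of `A ⊗ B`, with `⨁_{i + j = n} Aᵢ ⊗ Bⱼ` in degree `n`. -/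
abbrev tensorGrading (𝒜 : ℕ → Submodule K A) (ℬ : ℕ → Submodule K B) :
    ℕ → Submodule K (A ⊗[K] B) :=
  totalGrading (tensorBigrading 𝒜 ℬ)

/-- The Segre product `⨁ i, Aᵢ ⊗ Bᵢ`: the `(1, 1)`-diagonal of `A ⊗ B`. -/
abbrev segre (𝒜 : ℕ → Submodule K A) [SetLike.GradedMonoid 𝒜]
    (ℬ : ℕ → Submodule K B) [SetLike.GradedMonoid ℬ] : Subalgebra K (A ⊗[K] B) :=
  diagonal (tensorBigrading 𝒜 ℬ) 1 1

/-- The grading of the Segre product, with `Aᵢ ⊗ Bᵢ` in degree `i`. -/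
abbrev segreGrading (𝒜 : ℕ → Submodule K A) [SetLike.GradedMonoid 𝒜]
    (ℬ : ℕ → Submodule K B) [SetLike.GradedMonoid ℬ] : ℕ → Submodule K (segre 𝒜 ℬ) :=
  diagonalGrading (tensorBigrading 𝒜 ℬ) 1 1

end Tensor

end KoszulAlg

end

/-! Linearity is handled one syzygy at a time. `HasLinRes` says that a family of subspaces is
minimally generated in degree `0`, that its syzygies, moved down by one degree, are again so
generated, and so on. Applied to the residue field this is equivalent to a linear free resolution,
and since the first syzygy of `K` is the maximal ideal, Koszulness becomes linearity of `𝒜 (n + 1)`.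
As coefficients are only taken from the graded pieces, the Veronese and Segre rings can be treated
inside their ambient rings and transported to the subalgebras at the end.

By `HasLinRes.coinduct` it suffices to find a class of families that are minimally generated in
degree `0` and whose syzygies stay in the class. The horseshoe argument `IsSES.exists_minGen` shows
that linearity passes to extensions (`HasLinRes.extension`) and to the quotient of a linear module
by a linear submodule generated in the same degree (`HasLinRes.quotient`).

Over a Koszul algebra, a linear `M` with free cover `F` and syzygy module `Z` gives `0 → Z → 𝔪F →
M_{≥1} → 0`, so truncations of `M` are linear. Veronese: the syzygies of a Veronese module are the
Veronese of a truncation of the syzygies over `A`, so Veronese modules of linear modules form a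
closed class.

Tensor and Segre: if `F` is a free cover of `M`, the syzygies of `M ⊗ N` are an extension of `Syz M
⊗ N` by `F ⊗ Syz N`. Both ends are again of tensor type after shifting the factors: only the syzygy
factor is shifted for the total grading, both factors for the diagonal, where truncation is needed
for the other one. Iterated extensions of tensor families thus form a closed class
(`HasLinRes.tensor`). Applying this to `K ⊗ K` over `A ⊗ B` yields linearity of the augmentation
ideals. -/

noncomputable section

namespace KoszulAlg

universe u v w

/-! ### Linear resolutions as sequences of minimal generators -/

section LinearResolution

variable {K : Type v} {A : Type u} [Field K] [CommRing A] [Algebra K A]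

/-- The vectors with all entries in `𝒜 i`. -/
def vec (𝒜 : ℕ → Submodule K A) (ι : Type) (i : ℕ) : Submodule K (ι → A) :=
  Submodule.pi Set.univ fun _ => 𝒜 i

theorem mem_vec {𝒜 : ℕ → Submodule K A} {ι : Type} {i : ℕ} {v : ι → A} :
    v ∈ vec 𝒜 ι i ↔ ∀ j, v j ∈ 𝒜 i := by
  simp [vec, Submodule.mem_pi]

/-- The family of syzygies of `e` with coefficients in `𝒜 (i + 1)`. -/
def syz (𝒜 : ℕ → Submodule K A) {M : Type*} [AddCommGroup M] [Module A M] {ι : Type} [Fintype ι]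
    (e : ι → M) (i : ℕ) : Submodule K (ι → A) :=
  vec 𝒜 ι (i + 1) ⊓ (LinearMap.ker (Fintype.linearCombination A e)).restrictScalars K

theorem mem_syz {𝒜 : ℕ → Submodule K A} {M : Type*} [AddCommGroup M] [Module A M] {ι : Type}
    [Fintype ι] {e : ι → M} {i : ℕ} {v : ι → A} :
    v ∈ syz 𝒜 e i ↔ v ∈ vec 𝒜 ι (i + 1) ∧ Fintype.linearCombination A e v = 0 := by
  simp [syz]

/-- A family of subspaces closed under the action of the graded pieces of `A`. -/
def IsGradedFamily (𝒜 : ℕ → Submodule K A) {M : Type*} [AddCommGroup M] [Module K M] [Module A M]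
    (𝓜 : ℕ → Submodule K M) : Prop :=
  ∀ ⦃i j a m⦄, a ∈ 𝒜 i → m ∈ 𝓜 j → a • m ∈ 𝓜 (i + j)

/-- `e` is a minimal system of generators of `𝓜`, all of degree `0`. -/
structure IsMinGen (𝒜 : ℕ → Submodule K A) {M : Type*} [AddCommGroup M] [Module K M] [Module A M]
    (𝓜 : ℕ → Submodule K M) {ι : Type} [Fintype ι] (e : ι → M) : Prop where
  mem_iff : ∀ i m, m ∈ 𝓜 i ↔ ∃ v ∈ vec 𝒜 ι i, Fintype.linearCombination A e v = m
  eq_zero : ∀ v ∈ vec 𝒜 ι 0, Fintype.linearCombination A e v = 0 → v = 0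

/-- `𝓜` has a linear free resolution, described by successive minimal generators of syzygies. -/
def HasLinRes (𝒜 : ℕ → Submodule K A) {M : Type*} [AddCommGroup M] [Module K M] [Module A M]
    (𝓜 : ℕ → Submodule K M) : Prop :=
  ∃ (ι : ℕ → Type) (_ : ∀ n, Fintype (ι n)) (e₀ : ι 0 → M) (e : ∀ n, ι (n + 1) → ι n → A),
    IsMinGen 𝒜 𝓜 e₀ ∧ IsMinGen 𝒜 (syz 𝒜 e₀) (e 0) ∧ ∀ n, IsMinGen 𝒜 (syz 𝒜 (e n)) (e (n + 1))

variable {𝒜 : ℕ → Submodule K A}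

section

variable {M : Type w} [AddCommGroup M] [Module K M] [Module A M] {𝓜 : ℕ → Submodule K M}

theorem HasLinRes.exists_minGen (h : HasLinRes 𝒜 𝓜) :
    ∃ (ι : Type) (_ : Fintype ι) (e : ι → M), IsMinGen 𝒜 𝓜 e ∧ HasLinRes 𝒜 (syz 𝒜 e) := by
  obtain ⟨ι, _, e₀, e, h₀, h₁, h₂⟩ := h
  exact ⟨ι 0, inferInstance, e₀, h₀, fun n => ι (n + 1), inferInstance, e 0, fun n => e (n + 1),
    h₁, h₂ 0, fun n => h₂ (n + 1)⟩

theorem HasLinRes.of_minGen {ι : Type} [Fintype ι] {e : ι → M} (he : IsMinGen 𝒜 𝓜 e)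
    (h : HasLinRes 𝒜 (syz 𝒜 e)) : HasLinRes 𝒜 𝓜 := by
  obtain ⟨κ, _, e₀, e', h₀, h₁, h₂⟩ := h
  refine ⟨fun n => Nat.casesOn n ι κ, fun n => ?_, e, fun n => ?_, ?_⟩
  · cases n <;> dsimp only <;> infer_instance
  · cases n with
    | zero => exact e₀
    | succ n => exact e' n
  · refine ⟨he, h₀, fun n => ?_⟩
    cases n with
    | zero => exact h₁
    | succ n => exact h₂ n

end

/-- Linear resolutions are infinite objects, so closure properties are proved coinductively: a
property inherited by syzygies can be unrolled forever. -/
theorem HasLinRes.coinduct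
    (P : ∀ (M : Type u) [AddCommGroup M] [Module K M] [Module A M] [IsScalarTower K A M],
      (ℕ → Submodule K M) → Prop)
    (hP : ∀ (M : Type u) [AddCommGroup M] [Module K M] [Module A M] [IsScalarTower K A M]
      (𝓜 : ℕ → Submodule K M), P M 𝓜 →
      ∃ (ι : Type) (_ : Fintype ι) (e : ι → M), IsMinGen 𝒜 𝓜 e ∧ P (ι → A) (syz 𝒜 e))
    {M : Type u} [AddCommGroup M] [Module K M] [Module A M] [IsScalarTower K A M]
    {𝓜 : ℕ → Submodule K M} (h : P M 𝓜) : HasLinRes 𝒜 𝓜 := by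
  obtain ⟨ι, _, e, he, h⟩ := hP M 𝓜 h
  -- After one step every module has the form `κ → A` with `κ` finite, so the states of the
  -- recursion can be bundled by `κ` alone instead of by arbitrary modules.
  let σ : Type _ := Σ' (κ : Type) (_ : Fintype κ) (𝓧 : ℕ → Submodule K (κ → A)), P (κ → A) 𝓧
  choose k ik f hf hf' using fun s : σ => hP (s.1 → A) s.2.2.1 s.2.2.2
  let next : σ → σ := fun s => ⟨k s, ik s, syz 𝒜 (f s), hf' s⟩
  let seq : ℕ → σ := fun n => Nat.rec ⟨ι, inferInstance, syz 𝒜 e, h⟩ (fun _ s => next s) n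
  exact ⟨fun n => (seq n).1, fun n => (seq n).2.1, e, fun n => f (seq n), he, hf (seq 0),
    fun n => hf (seq (n + 1))⟩

end LinearResolution

/-! ### Degreewise exact sequences and the horseshoe argument -/

section Extensions

variable {K : Type v} {A : Type u} [Field K] [CommRing A] [Algebra K A] {𝒜 : ℕ → Submodule K A}

theorem comb_mem [SetLike.GradedMonoid 𝒜] {M : Type*} [AddCommGroup M] [Module K M] [Module A M]
    {𝓜 : ℕ → Submodule K M} (h𝓜 : IsGradedFamily 𝒜 𝓜) {ι : Type} [Fintype ι] {e : ι → M} {j : ℕ}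
    (he : ∀ k, e k ∈ 𝓜 j) {i : ℕ} {v : ι → A} (hv : v ∈ vec 𝒜 ι i) :
    Fintype.linearCombination A e v ∈ 𝓜 (i + j) := by
  rw [Fintype.linearCombination_apply]
  exact sum_mem fun k _ => h𝓜 (mem_vec.1 hv k) (he k)

theorem isGradedFamily_self [SetLike.GradedMonoid 𝒜] : IsGradedFamily 𝒜 𝒜 :=
  fun _ _ _ _ ha hm => SetLike.GradedMul.mul_mem ha hm

theorem isGradedFamily_vec [SetLike.GradedMonoid 𝒜] (ι : Type) : IsGradedFamily 𝒜 (vec 𝒜 ι) :=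
  fun _ _ _ _ ha hm => mem_vec.2 fun k => SetLike.GradedMul.mul_mem ha (mem_vec.1 hm k)

theorem IsGradedFamily.shift {M : Type*} [AddCommGroup M] [Module K M] [Module A M]
    {𝓜 : ℕ → Submodule K M} (h : IsGradedFamily 𝒜 𝓜) (p : ℕ) :
    IsGradedFamily 𝒜 fun i => 𝓜 (i + p) :=
  fun i j _ _ ha hm => by simpa [add_assoc] using h ha hm

theorem isGradedFamily_syz [SetLike.GradedMonoid 𝒜] {M : Type*} [AddCommGroup M] [Module A M]
    {ι : Type} [Fintype ι] (e : ι → M) : IsGradedFamily 𝒜 (syz 𝒜 e) := by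
  intro i j a m ha hm
  rw [mem_syz] at hm ⊢
  exact ⟨((isGradedFamily_vec ι).shift 1) ha hm.1, by rw [map_smul, hm.2, smul_zero]⟩

theorem single_mem_vec [SetLike.GradedMonoid 𝒜] {ι : Type} [DecidableEq ι] (j : ι) :
    Pi.single j (1 : A) ∈ vec 𝒜 ι 0 := by
  refine mem_vec.2 fun k => ?_
  by_cases h : k = j
  · subst h; simpa using SetLike.GradedOne.one_mem (A := 𝒜)
  · simp [h]

namespace IsMinGen

variable {M : Type*} [AddCommGroup M] [Module K M] [Module A M] {𝓜 : ℕ → Submodule K M}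
  {ι : Type} [Fintype ι] {e : ι → M}

theorem comb_mem (h : IsMinGen 𝒜 𝓜 e) {i : ℕ} {v : ι → A} (hv : v ∈ vec 𝒜 ι i) :
    Fintype.linearCombination A e v ∈ 𝓜 i :=
  (h.mem_iff i _).2 ⟨v, hv, rfl⟩

theorem mem [SetLike.GradedMonoid 𝒜] (h : IsMinGen 𝒜 𝓜 e) (j : ι) : e j ∈ 𝓜 0 := by
  classical
  simpa [Fintype.linearCombination_apply_single] using h.comb_mem (single_mem_vec j)

theorem isGradedFamily [SetLike.GradedMonoid 𝒜] (h : IsMinGen 𝒜 𝓜 e) : IsGradedFamily 𝒜 𝓜 := by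
  intro i j a m ha hm
  obtain ⟨v, hv, rfl⟩ := (h.mem_iff _ _).1 hm
  rw [← map_smul]
  exact h.comb_mem (isGradedFamily_vec ι ha hv)

end IsMinGen

theorem HasLinRes.isGradedFamily [SetLike.GradedMonoid 𝒜] {M : Type*} [AddCommGroup M] [Module K M]
    [Module A M] {𝓜 : ℕ → Submodule K M} (h : HasLinRes 𝒜 𝓜) : IsGradedFamily 𝒜 𝓜 := by
  obtain ⟨_, _, _, h, _⟩ := h.exists_minGen
  exact h.isGradedFamily

/-- A degreewise short exact sequence of families of subspaces. -/
structure IsSES {M₁ M₂ M₃ : Type*} [AddCommGroup M₁] [AddCommGroup M₂] [AddCommGroup M₃]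
    [Module K M₁] [Module K M₂] [Module K M₃] [Module A M₁] [Module A M₂] [Module A M₃]
    (𝓧 : ℕ → Submodule K M₁) (𝓨 : ℕ → Submodule K M₂) (𝓩 : ℕ → Submodule K M₃)
    (f : M₁ →ₗ[A] M₂) (g : M₂ →ₗ[A] M₃) : Prop where
  map_mem_left : ∀ ⦃i x⦄, x ∈ 𝓧 i → f x ∈ 𝓨 i
  eq_zero : ∀ ⦃i x⦄, x ∈ 𝓧 i → f x = 0 → x = 0
  map_mem_right : ∀ ⦃i y⦄, y ∈ 𝓨 i → g y ∈ 𝓩 i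
  exists_lift : ∀ ⦃i z⦄, z ∈ 𝓩 i → ∃ y ∈ 𝓨 i, g y = z
  comp_eq_zero : ∀ ⦃i x⦄, x ∈ 𝓧 i → g (f x) = 0
  exists_left : ∀ ⦃i y⦄, y ∈ 𝓨 i → g y = 0 → ∃ x ∈ 𝓧 i, f x = y

/-- Extension by zero of vectors from the first summand. -/
def extendInl (A : Type*) [CommRing A] (ι κ : Type) : (ι → A) →ₗ[A] (ι ⊕ κ → A) where
  toFun v := Sum.elim v 0
  map_add' v w := by ext (_ | _) <;> simp
  map_smul' a v := by ext (_ | _) <;> simp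

section SES

variable {M₁ M₂ M₃ : Type*} [AddCommGroup M₁] [AddCommGroup M₂] [AddCommGroup M₃]
  [Module K M₁] [Module K M₂] [Module K M₃] [Module A M₁] [Module A M₂] [Module A M₃]
  {𝓧 : ℕ → Submodule K M₁} {𝓨 : ℕ → Submodule K M₂} {𝓩 : ℕ → Submodule K M₃}
  {f : M₁ →ₗ[A] M₂} {g : M₂ →ₗ[A] M₃}

theorem comb_sumElim {ι κ : Type} [Fintype ι] [Fintype κ] (a : ι → M₁) (b : κ → M₁)
    (v : ι ⊕ κ → A) : Fintype.linearCombination A (Sum.elim a b) v =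
      Fintype.linearCombination A a (v ∘ Sum.inl) +
        Fintype.linearCombination A b (v ∘ Sum.inr) := by
  simp [Fintype.linearCombination_apply]

theorem comb_comp {ι : Type} [Fintype ι] (f : M₁ →ₗ[A] M₂) (a : ι → M₁) (v : ι → A) :
    Fintype.linearCombination A (f ∘ a) v = f (Fintype.linearCombination A a v) := by
  simp [Fintype.linearCombination_apply]

theorem comb_single {ι : Type} [Fintype ι] [DecidableEq ι] (v : ι → A) :
    Fintype.linearCombination A (fun j => (Pi.single j 1 : ι → A)) v = v := by
  ext k; simp [Fintype.linearCombination_apply, Pi.single_apply]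

theorem mem_vec_sum {ι κ : Type} {i : ℕ} {v : ι ⊕ κ → A} :
    v ∈ vec 𝒜 (ι ⊕ κ) i ↔ v ∘ Sum.inl ∈ vec 𝒜 ι i ∧ v ∘ Sum.inr ∈ vec 𝒜 κ i := by
  simp [mem_vec]

/-- Horseshoe lemma for one step: images of the generators on the left together with lifts of those
on the right generate the middle. Minimality is checked first on the right, then on the left.
Because all three families are generated in the same degree, the syzygies again form an exact
sequence. -/
theorem IsSES.exists_minGen [SetLike.GradedMonoid 𝒜] (h : IsSES 𝓧 𝓨 𝓩 f g)
    (h𝓨 : IsGradedFamily 𝒜 𝓨) {ι κ : Type} [Fintype ι] [Fintype κ] {eX : ι → M₁} {eZ : κ → M₃}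
    (hX : IsMinGen 𝒜 𝓧 eX) (hZ : IsMinGen 𝒜 𝓩 eZ) :
    ∃ eY : ι ⊕ κ → M₂, IsMinGen 𝒜 𝓨 eY ∧
      IsSES (syz 𝒜 eX) (syz 𝒜 eY) (syz 𝒜 eZ) (extendInl A ι κ) (LinearMap.funLeft A A Sum.inr) := by
  choose l hl hgl using fun j => h.exists_lift (hZ.mem j)
  have hgl' : ∀ v : κ → A, g (Fintype.linearCombination A l v) =
      Fintype.linearCombination A eZ v := fun v => by
    rw [← comb_comp]
    exact congrArg (Fintype.linearCombination A · v) (funext hgl)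
  have hcomb : ∀ v : ι ⊕ κ → A, Fintype.linearCombination A (Sum.elim (f ∘ eX) l) v =
      f (Fintype.linearCombination A eX (v ∘ Sum.inl)) +
        Fintype.linearCombination A l (v ∘ Sum.inr) := fun v => by
    rw [comb_sumElim, comb_comp]
  have hlm : ∀ {i} {v : κ → A}, v ∈ vec 𝒜 κ i → Fintype.linearCombination A l v ∈ 𝓨 i :=
    fun hv => by simpa using KoszulAlg.comb_mem h𝓨 hl hv
  have key : ∀ {i y} {w : κ → A}, y ∈ 𝓨 i → w ∈ vec 𝒜 κ i → g y = Fintype.linearCombination A eZ w →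
      ∃ v ∈ vec 𝒜 (ι ⊕ κ) i, v ∘ Sum.inr = w ∧
        Fintype.linearCombination A (Sum.elim (f ∘ eX) l) v = y := by
    -- The lift of `w` differs from `y` by an element coming from the left, which is absorbed by a
    -- combination of the left generators.
    intro i y w hy hw hyw
    obtain ⟨x, hx, hfx⟩ := h.exists_left (sub_mem hy (hlm hw)) (by rw [map_sub, hgl', hyw, sub_self])
    obtain ⟨u, hu, rfl⟩ := (hX.mem_iff _ _).1 hx
    refine ⟨Sum.elim u w, mem_vec_sum.2 ⟨by simpa using hu, by simpa using hw⟩, by simp, ?_⟩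
    rw [hcomb]
    simp [hfx]
  have hgc : ∀ {i} {v : ι ⊕ κ → A}, v ∈ vec 𝒜 (ι ⊕ κ) i →
      g (Fintype.linearCombination A (Sum.elim (f ∘ eX) l) v) =
        Fintype.linearCombination A eZ (v ∘ Sum.inr) := by
    intro i v hv
    rw [hcomb, map_add, hgl', h.comp_eq_zero (hX.comb_mem (mem_vec_sum.1 hv).1), zero_add]
  refine ⟨Sum.elim (f ∘ eX) l, ⟨fun i m => ⟨fun hm => ?_, ?_⟩, fun v hv hv0 => ?_⟩, ?_⟩
  · obtain ⟨w, hw, hwm⟩ := (hZ.mem_iff _ _).1 (h.map_mem_right hm)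
    obtain ⟨v, hv, -, hvm⟩ := key hm hw hwm.symm
    exact ⟨v, hv, hvm⟩
  · rintro ⟨v, hv, rfl⟩
    rw [hcomb]
    exact add_mem (h.map_mem_left (hX.comb_mem (mem_vec_sum.1 hv).1)) (hlm (mem_vec_sum.1 hv).2)
  · have h1 : v ∘ Sum.inr = 0 :=
      hZ.eq_zero _ (mem_vec_sum.1 hv).2 (by rw [← hgc hv, hv0, map_zero])
    have h2 : v ∘ Sum.inl = 0 := by
      rw [hcomb, h1, map_zero, add_zero] at hv0
      exact hX.eq_zero _ (mem_vec_sum.1 hv).1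
        (h.eq_zero (hX.comb_mem (mem_vec_sum.1 hv).1) hv0)
    ext (j | j)
    · exact congrFun h2 j
    · exact congrFun h1 j
  · constructor
    · intro i x hx
      rw [mem_syz] at hx ⊢
      refine ⟨mem_vec_sum.2 ⟨hx.1, zero_mem _⟩, ?_⟩
      rw [hcomb]
      have : (extendInl A ι κ x) ∘ Sum.inr = 0 := rfl
      have h' : (extendInl A ι κ x) ∘ Sum.inl = x := rfl
      rw [this, h', hx.2]; simp
    · intro i x _ hx
      ext j
      exact congrFun hx (Sum.inl j)
    · intro i y hy
      rw [mem_syz] at hy ⊢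
      exact ⟨(mem_vec_sum.1 hy.1).2, (hgc hy.1).symm.trans (by rw [hy.2, map_zero])⟩
    · intro i z hz
      rw [mem_syz] at hz
      -- `key` with `y = 0` completes a syzygy on the right to one in the middle.
      obtain ⟨v, hv, hvz, hv0⟩ := key (zero_mem (𝓨 (i + 1))) hz.1 (by rw [hz.2, map_zero])
      exact ⟨v, mem_syz.2 ⟨hv, hv0⟩, hvz⟩
    · intro i x _
      rfl
    · intro i y hy hy0
      rw [mem_syz] at hy
      have hy0 : y ∘ Sum.inr = 0 := hy0
      refine ⟨y ∘ Sum.inl, mem_syz.2 ⟨(mem_vec_sum.1 hy.1).1, ?_⟩, ?_⟩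
      · have := hy.2
        rw [hcomb, hy0, map_zero, add_zero] at this
        exact h.eq_zero (hX.comb_mem (mem_vec_sum.1 hy.1).1) this
      · ext (j | j)
        · rfl
        · exact (congrFun hy0 j).symm

end SES

end Extensions

/-! ### Extensions, quotients, truncations and Veronese modules -/

section Ops

variable {K : Type v} {A : Type u} [Field K] [CommRing A] [Algebra K A] {𝒜 : ℕ → Submodule K A}

/-- Degreewise isomorphic families, the isomorphism being induced by a linear map. -/
theorem HasLinRes.of_iso {M₁ M₂ : Type*} [AddCommGroup M₁] [AddCommGroup M₂]
    [Module K M₁] [Module K M₂] [Module A M₁] [Module A M₂]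
    {𝓧 : ℕ → Submodule K M₁} {𝓨 : ℕ → Submodule K M₂} (f : M₁ →ₗ[A] M₂)
    (hf : ∀ i x, x ∈ 𝓧 i → f x = 0 → x = 0) (hf' : ∀ i y, y ∈ 𝓨 i ↔ ∃ x ∈ 𝓧 i, f x = y)
    (hX : HasLinRes 𝒜 𝓧) : HasLinRes 𝒜 𝓨 := by
  obtain ⟨ι, _, e, he, hX⟩ := hX.exists_minGen
  refine HasLinRes.of_minGen (e := f ∘ e) ⟨fun i m => ?_, fun v hv hv0 => ?_⟩ ?_
  · rw [hf']
    constructor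
    · rintro ⟨x, hx, rfl⟩
      obtain ⟨v, hv, rfl⟩ := (he.mem_iff _ _).1 hx
      exact ⟨v, hv, comb_comp _ _ _⟩
    · rintro ⟨v, hv, rfl⟩
      exact ⟨_, he.comb_mem hv, (comb_comp _ _ _).symm⟩
  · rw [comb_comp] at hv0
    exact he.eq_zero _ hv (hf _ _ (he.comb_mem hv) hv0)
  · convert hX using 1
    ext i v
    rw [mem_syz, mem_syz, comb_comp]
    exact and_congr_right fun hv => ⟨hf _ _ (he.comb_mem hv), fun h => by rw [h, map_zero]⟩

theorem comb_comb {M : Type*} [AddCommGroup M] [Module A M] {ι κ : Type} [Fintype ι] [Fintype κ]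
    (e : ι → M) (c : κ → ι → A) (v : κ → A) :
    Fintype.linearCombination A (fun k => Fintype.linearCombination A e (c k)) v =
      Fintype.linearCombination A e (Fintype.linearCombination A c v) :=
  comb_comp (Fintype.linearCombination A e) c v

/-- A finite system of generators contains a minimal one. -/
theorem exists_isMinGen_of_generators (h0 : ∀ a ∈ 𝒜 0, ∃ c : K, algebraMap K A c = a)
    {M : Type*} [AddCommGroup M] [Module K M] [Module A M] [IsScalarTower K A M]
    {𝓜 : ℕ → Submodule K M} {ι : Type} [Fintype ι] (z : ι → M)
    (hz : ∀ i m, m ∈ 𝓜 i ↔ ∃ v ∈ vec 𝒜 ι i, Fintype.linearCombination A z v = m) :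
    ∃ (κ : Type) (_ : Fintype κ) (e : κ → M), IsMinGen 𝒜 𝓜 e := by
  classical
  -- A maximal `K`-independent subfamily works: since `𝒜 0` consists of scalars, linear independence
  -- over `K` is exactly minimality.
  obtain ⟨κ, a, ha, hspan, hli⟩ := exists_linearIndependent' K z
  have : Fintype κ := Fintype.ofInjective a ha
  have hc : ∀ j, ∃ c : κ → K, ∑ k, c k • z (a k) = z j := fun j => by
    have : z j ∈ Submodule.span K (Set.range (z ∘ a)) := by
      rw [hspan]; exact Submodule.subset_span ⟨j, rfl⟩
    rw [Submodule.mem_span_range_iff_exists_fun] at this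
    exact this
  choose c hc using hc
  refine ⟨κ, this, z ∘ a, fun i m => ?_, fun v hv hv0 => ?_⟩
  · rw [hz]
    constructor
    · rintro ⟨v, hv, rfl⟩
      refine ⟨fun k => ∑ j, c j k • v j, mem_vec.2 fun k => sum_mem fun j _ =>
        Submodule.smul_mem _ _ (mem_vec.1 hv j), ?_⟩
      simp only [Fintype.linearCombination_apply, Finset.sum_smul]
      rw [Finset.sum_comm]
      refine Finset.sum_congr rfl fun j _ => ?_
      conv_rhs => rw [← hc j, Finset.smul_sum]
      refine Finset.sum_congr rfl fun k _ => ?_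
      rw [smul_assoc, ← algebraMap_smul A (c j k) (z (a k)), smul_smul, mul_comm, mul_smul,
        algebraMap_smul]
      rfl
    · rintro ⟨v, hv, rfl⟩
      refine ⟨fun j => ∑ k, if a k = j then v k else 0, mem_vec.2 fun j => sum_mem fun k _ => ?_, ?_⟩
      · split_ifs
        · exact mem_vec.1 hv k
        · exact zero_mem _
      · simp only [Fintype.linearCombination_apply, Finset.sum_smul, ite_smul, zero_smul]
        rw [Finset.sum_comm]
        simp
  · choose d hd using fun k => h0 _ (mem_vec.1 hv k)
    have hd0 : ∑ k, d k • (z ∘ a) k = 0 := by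
      rw [← hv0, Fintype.linearCombination_apply]
      refine Finset.sum_congr rfl fun k _ => ?_
      rw [← hd k, algebraMap_smul]
    have := Fintype.linearIndependent_iff.1 hli d hd0
    ext k
    rw [← hd k, this k, map_zero]; rfl

theorem HasLinRes.of_eq_bot {M : Type u} [AddCommGroup M] [Module K M] [Module A M]
    [IsScalarTower K A M] {𝓜 : ℕ → Submodule K M} (h : ∀ i, 𝓜 i = ⊥) : HasLinRes 𝒜 𝓜 := by
  refine HasLinRes.coinduct (fun M _ _ _ _ 𝓜 => ∀ i, 𝓜 i = ⊥) ?_ h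
  intro M _ _ _ _ 𝓜 h
  refine ⟨Empty, inferInstance, Empty.elim, ⟨fun i m => ?_, fun v _ _ => Subsingleton.elim _ _⟩,
    fun i => Subsingleton.elim _ _⟩
  rw [h, Submodule.mem_bot]
  simp only [Fintype.linearCombination_apply, Finset.univ_eq_empty, Finset.sum_empty]
  exact ⟨fun h => ⟨0, zero_mem _, h.symm⟩, fun ⟨_, _, h⟩ => h.symm⟩

theorem isGradedFamily_pi {M : Type*} [AddCommGroup M] [Module K M] [Module A M]
    {𝓜 : ℕ → Submodule K M} (h : IsGradedFamily 𝒜 𝓜) (ι : Type) :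
    IsGradedFamily 𝒜 fun i => Submodule.pi (Set.univ : Set ι) fun _ => 𝓜 i := by
  intro i j a m ha hm
  simp only [Submodule.mem_pi, Set.mem_univ, true_imp_iff] at hm ⊢
  exact fun k => h ha (hm k)

variable [SetLike.GradedMonoid 𝒜]

theorem HasLinRes.extension {M₁ M₂ M₃ : Type u} [AddCommGroup M₁] [AddCommGroup M₂] [AddCommGroup M₃]
    [Module K M₁] [Module K M₂] [Module K M₃] [Module A M₁] [Module A M₂] [Module A M₃]
    [IsScalarTower K A M₁] [IsScalarTower K A M₂] [IsScalarTower K A M₃]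
    {𝓧 : ℕ → Submodule K M₁} {𝓨 : ℕ → Submodule K M₂} {𝓩 : ℕ → Submodule K M₃}
    {f : M₁ →ₗ[A] M₂} {g : M₂ →ₗ[A] M₃} (h : IsSES 𝓧 𝓨 𝓩 f g) (h𝓨 : IsGradedFamily 𝒜 𝓨)
    (hX : HasLinRes 𝒜 𝓧) (hZ : HasLinRes 𝒜 𝓩) : HasLinRes 𝒜 𝓨 := by
  refine HasLinRes.coinduct (fun M _ _ _ _ 𝓨 => IsGradedFamily 𝒜 𝓨 ∧
    ∃ (M₁ M₃ : Type u) (_ : AddCommGroup M₁) (_ : AddCommGroup M₃) (_ : Module K M₁)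
      (_ : Module K M₃) (_ : Module A M₁) (_ : Module A M₃)
      (𝓧 : ℕ → Submodule K M₁) (𝓩 : ℕ → Submodule K M₃)
      (f : M₁ →ₗ[A] M) (g : M →ₗ[A] M₃), IsSES 𝓧 𝓨 𝓩 f g ∧ HasLinRes 𝒜 𝓧 ∧ HasLinRes 𝒜 𝓩)
    ?_ ⟨h𝓨, M₁, M₃, inferInstance, inferInstance, inferInstance, inferInstance, inferInstance,
      inferInstance, 𝓧, 𝓩, f, g, h, hX, hZ⟩
  rintro M _ _ _ _ 𝓨 ⟨h𝓨, M₁, M₃, _, _, _, _, _, _, 𝓧, 𝓩, f, g, h, hX, hZ⟩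
  obtain ⟨ι, _, eX, heX, hX⟩ := hX.exists_minGen
  obtain ⟨κ, _, eZ, heZ, hZ⟩ := hZ.exists_minGen
  obtain ⟨eY, heY, hY⟩ := h.exists_minGen h𝓨 heX heZ
  exact ⟨_, _, eY, heY, isGradedFamily_syz eY, _, _, _, _, _, _, _, _, _, _, _, _, hY, hX, hZ⟩

theorem comb_mem_vec {ι κ : Type} [Fintype κ] {c : κ → ι → A} {i j : ℕ} (hc : ∀ k, c k ∈ vec 𝒜 ι j)
    {v : κ → A} (hv : v ∈ vec 𝒜 κ i) : Fintype.linearCombination A c v ∈ vec 𝒜 ι (i + j) :=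
  comb_mem (isGradedFamily_vec ι) hc hv

/-- Two minimal systems are expressed in each other by matrices with entries of degree `0`.
Minimality forces these to be mutually inverse, so the two syzygy families are isomorphic. This
frees later arguments from the generators hidden in a given resolution. -/
theorem HasLinRes.syz_of_minGen {M : Type*} [AddCommGroup M] [Module K M] [Module A M]
    {𝓜 : ℕ → Submodule K M} (h : HasLinRes 𝒜 𝓜) {κ : Type} [Fintype κ] {e' : κ → M}
    (he' : IsMinGen 𝒜 𝓜 e') : HasLinRes 𝒜 (syz 𝒜 e') := by
  classical
  obtain ⟨ι, _, e, he, h⟩ := h.exists_minGen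
  choose c hc hce using fun j => (he'.mem_iff _ _).1 (he.mem j)
  choose d hd hde using fun j => (he.mem_iff _ _).1 (he'.mem j)
  have e1 : ∀ v, Fintype.linearCombination A e' (Fintype.linearCombination A c v) =
      Fintype.linearCombination A e v := fun v => by
    rw [← comb_comb]; congr 1; ext1; simp only [hce]
  have e2 : ∀ v, Fintype.linearCombination A e (Fintype.linearCombination A d v) =
      Fintype.linearCombination A e' v := fun v => by
    rw [← comb_comb]; congr 1; ext1; simp only [hde]
  have c1 : ∀ j, Fintype.linearCombination A d (c j) = Pi.single j 1 := fun j => by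
    rw [← sub_eq_zero]
    refine he.eq_zero _ (sub_mem (comb_mem_vec hd (hc j)) (single_mem_vec j)) ?_
    rw [map_sub, e2, hce, Fintype.linearCombination_apply_single, one_smul, sub_self]
  have c2 : ∀ j, Fintype.linearCombination A c (d j) = Pi.single j 1 := fun j => by
    rw [← sub_eq_zero]
    refine he'.eq_zero _ (sub_mem (comb_mem_vec hc (hd j)) (single_mem_vec j)) ?_
    rw [map_sub, e1, hde, Fintype.linearCombination_apply_single, one_smul, sub_self]
  have d1 : ∀ v, Fintype.linearCombination A d (Fintype.linearCombination A c v) = v := fun v => by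
    rw [← comb_comb]; simp only [c1, comb_single]
  have d2 : ∀ v, Fintype.linearCombination A c (Fintype.linearCombination A d v) = v := fun v => by
    rw [← comb_comb]; simp only [c2, comb_single]
  refine HasLinRes.of_iso (Fintype.linearCombination A c) (fun i x _ hx => ?_) (fun i y => ?_) h
  · rw [← d1 x, hx, map_zero]
  · constructor
    · intro hy
      rw [mem_syz] at hy
      exact ⟨Fintype.linearCombination A d y, mem_syz.2 ⟨comb_mem_vec hd hy.1, by rw [e2, hy.2]⟩,
        d2 y⟩
    · rintro ⟨x, hx, rfl⟩
      rw [mem_syz] at hx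
      exact mem_syz.2 ⟨comb_mem_vec hc hx.1, by rw [e1, hx.2]⟩

/-- A minimal system for the quotient can be chosen among images of generators of the middle term.
Its lifts, joined with the generators on the left, give a possibly new minimal system of the middle
term, whose syzygies are still linear by `HasLinRes.syz_of_minGen`. The syzygies thus satisfy the
same hypotheses. -/
theorem HasLinRes.quotient (h0 : ∀ a ∈ 𝒜 0, ∃ c : K, algebraMap K A c = a)
    {M₁ M₂ M₃ : Type u} [AddCommGroup M₁] [AddCommGroup M₂] [AddCommGroup M₃]
    [Module K M₁] [Module K M₂] [Module K M₃] [Module A M₁] [Module A M₂] [Module A M₃]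
    [IsScalarTower K A M₁] [IsScalarTower K A M₂] [IsScalarTower K A M₃]
    {𝓧 : ℕ → Submodule K M₁} {𝓨 : ℕ → Submodule K M₂} {𝓩 : ℕ → Submodule K M₃}
    {f : M₁ →ₗ[A] M₂} {g : M₂ →ₗ[A] M₃} (h : IsSES 𝓧 𝓨 𝓩 f g)
    (hX : HasLinRes 𝒜 𝓧) (hY : HasLinRes 𝒜 𝓨) : HasLinRes 𝒜 𝓩 := by
  refine HasLinRes.coinduct (fun M _ _ _ _ 𝓩 =>
    ∃ (M₁ M₂ : Type u) (_ : AddCommGroup M₁) (_ : AddCommGroup M₂) (_ : Module K M₁)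
      (_ : Module K M₂) (_ : Module A M₁) (_ : Module A M₂)
      (𝓧 : ℕ → Submodule K M₁) (𝓨 : ℕ → Submodule K M₂)
      (f : M₁ →ₗ[A] M₂) (g : M₂ →ₗ[A] M), IsSES 𝓧 𝓨 𝓩 f g ∧ HasLinRes 𝒜 𝓧 ∧ HasLinRes 𝒜 𝓨)
    ?_ ⟨M₁, M₂, inferInstance, inferInstance, inferInstance, inferInstance, inferInstance,
      inferInstance, 𝓧, 𝓨, f, g, h, hX, hY⟩
  rintro M _ _ _ _ 𝓩 ⟨M₁, M₂, _, _, _, _, _, _, 𝓧, 𝓨, f, g, h, hX, hY⟩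
  obtain ⟨ι, _, eX, heX, hX⟩ := hX.exists_minGen
  obtain ⟨κ, _, eY, heY, -⟩ := hY.exists_minGen
  obtain ⟨τ, _, eZ, heZ⟩ := exists_isMinGen_of_generators h0 (𝓜 := 𝓩) (g ∘ eY) fun i m => by
    constructor
    · intro hm
      obtain ⟨y, hy, rfl⟩ := h.exists_lift hm
      obtain ⟨v, hv, rfl⟩ := (heY.mem_iff _ _).1 hy
      exact ⟨v, hv, comb_comp _ _ _⟩
    · rintro ⟨v, hv, rfl⟩
      rw [comb_comp]
      exact h.map_mem_right (heY.comb_mem hv)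
  obtain ⟨e, he, hS⟩ := h.exists_minGen heY.isGradedFamily heX heZ
  exact ⟨τ, _, eZ, heZ, _, _, _, _, _, _, _, _, _, _, _, _, hS, hX, hY.syz_of_minGen he⟩

theorem HasLinRes.pi_fin {M : Type u} [AddCommGroup M] [Module K M] [Module A M]
    [IsScalarTower K A M] {𝓜 : ℕ → Submodule K M} (h : HasLinRes 𝒜 𝓜) (n : ℕ) :
    HasLinRes 𝒜 fun i => Submodule.pi (Set.univ : Set (Fin n)) fun _ => 𝓜 i := by
  induction n with
  | zero => exact HasLinRes.of_eq_bot fun i => Subsingleton.elim _ _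
  | succ n ih =>
    refine HasLinRes.extension (f := LinearMap.single A (fun _ : Fin (n + 1) => M) 0)
      (g := LinearMap.funLeft A M Fin.succ) ?_ (isGradedFamily_pi h.isGradedFamily _) h ih
    constructor
    · intro i x hx
      simp only [Submodule.mem_pi, Set.mem_univ, true_imp_iff, LinearMap.coe_single]
      intro k
      by_cases hk : k = 0
      · subst hk; simpa using hx
      · simp [hk]
    · intro i x _ hx
      simpa using congrFun hx 0
    · intro i y hy
      simp only [Submodule.mem_pi, Set.mem_univ, true_imp_iff] at hy ⊢
      exact fun k => hy k.succ
    · intro i z hz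
      simp only [Submodule.mem_pi, Set.mem_univ, true_imp_iff] at hz
      refine ⟨Fin.cons 0 z, ?_, ?_⟩
      · simp only [Submodule.mem_pi, Set.mem_univ, true_imp_iff]
        intro k
        refine Fin.cases ?_ (fun k => ?_) k
        · exact zero_mem _
        · simpa using hz k
      · ext k; simp [LinearMap.funLeft_apply]
    · intro i x _
      ext k; simp [LinearMap.funLeft_apply]
    · intro i y hy hy0
      simp only [Submodule.mem_pi, Set.mem_univ, true_imp_iff] at hy
      refine ⟨y 0, hy 0, ?_⟩
      ext k
      refine Fin.cases ?_ (fun k => ?_) k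
      · simp
      · simpa [LinearMap.funLeft_apply] using (congrFun hy0 k).symm

theorem HasLinRes.pi {M : Type u} [AddCommGroup M] [Module K M] [Module A M]
    [IsScalarTower K A M] {𝓜 : ℕ → Submodule K M} (h : HasLinRes 𝒜 𝓜) (ι : Type) [Fintype ι] :
    HasLinRes 𝒜 fun i => Submodule.pi (Set.univ : Set ι) fun _ => 𝓜 i := by
  let q := Fintype.equivFin ι
  refine HasLinRes.of_iso (LinearMap.funLeft A M q) (fun i x _ hx => ?_) (fun i y => ?_)
    (h.pi_fin (Fintype.card ι))
  · ext k
    simpa [LinearMap.funLeft_apply] using congrFun hx (q.symm k)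
  · simp only [Submodule.mem_pi, Set.mem_univ, true_imp_iff]
    constructor
    · intro hy
      exact ⟨y ∘ q.symm, fun k => hy _, by ext k; simp [LinearMap.funLeft_apply]⟩
    · rintro ⟨x, hx, rfl⟩ k
      exact hx _

/-- With free cover `F → M`, the sequence `0 → Syz M → 𝔪F → M_{≥1} → 0` has linear left and middle
terms. All three are placed with their degree `1` part in degree `0`. -/
theorem HasLinRes.shift_one (h0 : ∀ a ∈ 𝒜 0, ∃ c : K, algebraMap K A c = a)
    (hA : HasLinRes 𝒜 fun i => 𝒜 (i + 1)) {M : Type u} [AddCommGroup M] [Module K M] [Module A M]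
    [IsScalarTower K A M] {𝓜 : ℕ → Submodule K M} (h : HasLinRes 𝒜 𝓜) :
    HasLinRes 𝒜 fun i => 𝓜 (i + 1) := by
  obtain ⟨ι, _, e, he, h⟩ := h.exists_minGen
  refine HasLinRes.quotient h0 (f := LinearMap.id) (g := Fintype.linearCombination A e) ?_ h
    (hA.pi ι)
  constructor
  · exact fun i x hx => (mem_syz.1 hx).1
  · exact fun i x _ hx => hx
  · exact fun i y hy => he.comb_mem (i := i + 1) hy
  · exact fun i z hz => (he.mem_iff _ _).1 hz
  · exact fun i x hx => (mem_syz.1 hx).2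
  · exact fun i y hy hy0 => ⟨y, mem_syz.2 ⟨hy, hy0⟩, rfl⟩

theorem HasLinRes.shift (h0 : ∀ a ∈ 𝒜 0, ∃ c : K, algebraMap K A c = a)
    (hA : HasLinRes 𝒜 fun i => 𝒜 (i + 1)) {M : Type u} [AddCommGroup M] [Module K M] [Module A M]
    [IsScalarTower K A M] {𝓜 : ℕ → Submodule K M} (h : HasLinRes 𝒜 𝓜) (p : ℕ) :
    HasLinRes 𝒜 fun i => 𝓜 (i + p) := by
  induction p with
  | zero => simpa using h
  | succ p ih =>
    simpa only [add_assoc, add_comm 1] using HasLinRes.shift_one h0 hA ih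

/-- The invariant class consists of the families `𝓜 (i * d)` with `𝓜` linear over `𝒜`. The
generators of `𝓜` also generate its Veronese family, and truncation keeps the syzygies in the class.
-/
theorem HasLinRes.veronese (h0 : ∀ a ∈ 𝒜 0, ∃ c : K, algebraMap K A c = a)
    (hA : HasLinRes 𝒜 fun i => 𝒜 (i + 1)) {d : ℕ} (hd : 1 ≤ d) {M : Type u} [AddCommGroup M]
    [Module K M] [Module A M] [IsScalarTower K A M] {𝓜 : ℕ → Submodule K M} (h : HasLinRes 𝒜 𝓜) :
    HasLinRes (veroneseComponent 𝒜 d) fun i => 𝓜 (i * d) := by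
  refine HasLinRes.coinduct (fun M _ _ _ _ 𝓧 => ∃ 𝓜 : ℕ → Submodule K M, HasLinRes 𝒜 𝓜 ∧
    𝓧 = fun i => 𝓜 (i * d)) ?_ ⟨𝓜, h, rfl⟩
  rintro M _ _ _ _ _ ⟨𝓜, h, rfl⟩
  obtain ⟨ι, _, e, he, h⟩ := h.exists_minGen
  refine ⟨ι, _, e, ⟨fun i m => he.mem_iff (i * d) m, fun v hv => he.eq_zero v ?_⟩,
    _, HasLinRes.shift h0 hA h (d - 1), ?_⟩
  · simpa [mem_vec, veroneseComponent] using hv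
  · ext i v
    rw [mem_syz, mem_syz]
    -- `syz` already lowers degrees by one, so moving down by one Veronese degree, that is by `d`,
    -- needs a further shift by only `d - 1`.
    have : i * d + (d - 1) + 1 = (i + 1) * d := by
      rw [add_assoc, Nat.sub_add_cancel hd]; ring
    rw [this]; rfl

end Ops

/-! ### Subspaces of tensor products over a field -/

section TensorFamilies

variable {K : Type*} [Field K] {M N P : Type*} [AddCommGroup M] [AddCommGroup N] [AddCommGroup P]
  [Module K M] [Module K N] [Module K P]

/-- The subspace `U ⊗ V` of `M ⊗ N`. -/
def tens (U : Submodule K M) (V : Submodule K N) : Submodule K (M ⊗[K] N) :=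
  Submodule.map₂ (TensorProduct.mk K M N) U V

theorem range_map_subtype (U : Submodule K M) (V : Submodule K N) :
    LinearMap.range (TensorProduct.map U.subtype V.subtype) = tens U V :=
  TensorProduct.range_mapIncl U V

theorem tmul_mem_tens {U : Submodule K M} {V : Submodule K N} {m : M} {n : N} (hm : m ∈ U)
    (hn : n ∈ V) : m ⊗ₜ[K] n ∈ tens U V :=
  Submodule.apply_mem_map₂ _ hm hn

theorem tens_le {U : Submodule K M} {V : Submodule K N} {W : Submodule K (M ⊗[K] N)} :
    tens U V ≤ W ↔ ∀ m ∈ U, ∀ n ∈ V, m ⊗ₜ[K] n ∈ W :=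
  Submodule.map₂_le

theorem map_tens {M' N' : Type*} [AddCommGroup M'] [AddCommGroup N'] [Module K M'] [Module K N']
    (f : M →ₗ[K] M') (g : N →ₗ[K] N') (U : Submodule K M) (V : Submodule K N) :
    (tens U V).map (TensorProduct.map f g) = tens (U.map f) (V.map g) := by
  rw [tens, tens, Submodule.map_map₂, Submodule.map₂_map_map]
  rfl

/-- Flatness is used twice: `P ⊗ V` embeds in `P ⊗ N`, so the element already vanishes in `P ⊗ V`;
and tensoring with `V` is exact, so it comes from the kernel on `U` tensored with `V`. -/
theorem tens_inf_ker_left (f : M →ₗ[K] P) (U : Submodule K M) (V : Submodule K N) :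
    tens U V ⊓ LinearMap.ker (f.rTensor N) ≤ tens (U ⊓ LinearMap.ker f) V := by
  rintro x ⟨hx, hx0⟩
  rw [← range_map_subtype] at hx
  obtain ⟨t, rfl⟩ := hx
  set f' := f ∘ₗ U.subtype with hf'
  have h1 : V.subtype.lTensor P (f'.rTensor V t) = 0 := by
    rw [← LinearMap.mem_ker.1 hx0, ← LinearMap.comp_apply, ← LinearMap.comp_apply]
    congr 1
    ext; simp [hf']
  have h2 : f'.rTensor V t = 0 :=
    Module.Flat.lTensor_preserves_injective_linearMap (M := P) V.subtype V.injective_subtype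
      (h1.trans (map_zero _).symm)
  obtain ⟨s, rfl⟩ := (Module.Flat.rTensor_exact V (LinearMap.exact_subtype_ker_map f') t).1 h2
  have h3 : (TensorProduct.map U.subtype V.subtype) ((LinearMap.ker f').subtype.rTensor V s) =
      TensorProduct.map (U.subtype ∘ₗ (LinearMap.ker f').subtype) V.subtype s := by
    rw [← LinearMap.comp_apply]
    congr 1
    ext; simp
  rw [h3]
  have h4 := LinearMap.mem_range_self
    (TensorProduct.map (U.subtype ∘ₗ (LinearMap.ker f').subtype) V.subtype) s
  rw [TensorProduct.range_map] at h4
  refine Submodule.map₂_le_map₂ ?_ (by simp) h4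
  rintro _ ⟨y, rfl⟩
  exact ⟨(y : U).2, y.2⟩

theorem tens_inf_ker_right (g : N →ₗ[K] P) (U : Submodule K M) (V : Submodule K N) :
    tens U V ⊓ LinearMap.ker (g.lTensor M) ≤ tens U (V ⊓ LinearMap.ker g) := by
  rintro x ⟨hx, hx0⟩
  have hc : ∀ (U : Submodule K M) (V : Submodule K N),
      (tens U V).map (TensorProduct.comm K M N).toLinearMap = tens V U := fun U V => by
    rw [tens, Submodule.map_map₂, tens, ← Submodule.map₂_flip]
    rfl
  have h := tens_inf_ker_left g V U (x := TensorProduct.comm K M N x) ⟨?_, ?_⟩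
  · rw [← hc] at h
    obtain ⟨y, hy, hyx⟩ := h
    rwa [← (TensorProduct.comm K M N).injective hyx]
  · rw [← hc]; exact ⟨x, hx, rfl⟩
  · have : g.rTensor M (TensorProduct.comm K M N x) =
        TensorProduct.comm K M P (g.lTensor M x) := by
      exact LinearMap.congr_fun (f := g.rTensor M ∘ₗ (TensorProduct.comm K M N).toLinearMap)
        (g := (TensorProduct.comm K M P).toLinearMap ∘ₗ g.lTensor M)
        (TensorProduct.ext' fun _ _ => by simp) x
    exact this.trans (by rw [LinearMap.mem_ker.1 hx0, map_zero])

/-- Over a field, the tensor product of the two injections from the direct sums is injective, and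
tensor products commute with direct sums. -/
theorem iSupIndep_tens {ι κ : Type*} {𝓜 : ι → Submodule K M} {𝓝 : κ → Submodule K N}
    (h𝓜 : iSupIndep 𝓜) (h𝓝 : iSupIndep 𝓝) :
    iSupIndep fun p : ι × κ => tens (𝓜 p.1) (𝓝 p.2) := by
  classical
  rw [iSupIndep_iff_finsetSum_eq_zero_imp_eq_zero]
  intro s x hx hx0
  have hx' : ∀ p : ι × κ, ∃ t : 𝓜 p.1 ⊗[K] 𝓝 p.2, p ∈ s →
      TensorProduct.map (𝓜 p.1).subtype (𝓝 p.2).subtype t = x p := by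
    intro p
    by_cases hp : p ∈ s
    · have := hx p hp
      rw [← range_map_subtype] at this
      exact this.imp fun t ht _ => ht
    · exact ⟨0, fun h => absurd h hp⟩
  choose t ht using hx'
  let c := TensorProduct.map (DirectSum.coeLinearMap 𝓜) (DirectSum.coeLinearMap 𝓝)
  have hc : Function.Injective c := by
    have : c = (DirectSum.coeLinearMap 𝓝).lTensor M ∘ₗ
        (DirectSum.coeLinearMap 𝓜).rTensor _ := by
      rw [LinearMap.lTensor_comp_rTensor]
    rw [this]
    exact (Module.Flat.lTensor_preserves_injective_linearMap _ h𝓝.dfinsupp_lsum_injective).comp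
      (Module.Flat.rTensor_preserves_injective_linearMap _ h𝓜.dfinsupp_lsum_injective)
  let E := TensorProduct.directSum K K (fun i => 𝓜 i) (fun j => 𝓝 j)
  have hlof : ∀ (p : ι × κ) (y : 𝓜 p.1 ⊗[K] 𝓝 p.2),
      c (E.symm (DirectSum.lof K _ (fun p : ι × κ => 𝓜 p.1 ⊗[K] 𝓝 p.2) p y)) =
        TensorProduct.map (𝓜 p.1).subtype (𝓝 p.2).subtype y := by
    intro p y
    induction y with
    | zero => simp
    | add a b ha hb => simp only [map_add, ha, hb]
    | tmul a b =>
      obtain ⟨i, j⟩ := p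
      simp [E, c, TensorProduct.directSum_symm_lof_tmul]
  have hsum : ∑ p ∈ s, DirectSum.lof K _ (fun p : ι × κ => 𝓜 p.1 ⊗[K] 𝓝 p.2) p (t p) = 0 := by
    apply E.symm.injective
    apply hc
    rw [map_sum, map_sum, map_zero, map_zero, ← hx0]
    exact Finset.sum_congr rfl fun p hp => by rw [hlof, ht p hp]
  intro p hp
  have := congrArg (DirectSum.component K _ (fun p : ι × κ => 𝓜 p.1 ⊗[K] 𝓝 p.2) p) hsum
  rw [map_sum, map_zero, Finset.sum_eq_single p] at this
  · rw [DirectSum.component.lof_self] at this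
    rw [← ht p hp, this, map_zero]
  · intro q _ hq
    rw [DirectSum.component.of, dif_neg hq]
  · exact fun h => absurd hp h

/-- The images of the pieces lie in independent subspaces, so if their sum is zero then each of them
is zero: the kernel is homogeneous. -/
theorem mem_biSup_inf_ker {ι : Type*} (L : M →ₗ[K] P) {𝓤 : ι → Submodule K M}
    {𝓦 : ι → Submodule K P} (h𝓦 : iSupIndep 𝓦) (hL : ∀ i, ∀ x ∈ 𝓤 i, L x ∈ 𝓦 i) (I : Set ι) {x : M}
    (hx : x ∈ ⨆ i ∈ I, 𝓤 i) (hx0 : L x = 0) : x ∈ ⨆ i ∈ I, 𝓤 i ⊓ LinearMap.ker L := by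
  rw [Submodule.mem_iSup_iff_exists_finsupp] at hx
  obtain ⟨f, hf, rfl⟩ := hx
  have hle : ∀ i, (⨆ _ : i ∈ I, 𝓤 i) ≤ 𝓤 i := fun i => iSup_le fun _ => le_rfl
  have h0 := (iSupIndep_iff_finsetSum_eq_zero_imp_eq_zero 𝓦).1 h𝓦 f.support (fun i => L (f i))
    (fun i _ => hL i _ (hle i (hf i))) (by rwa [Finsupp.sum, map_sum] at hx0)
  refine sum_mem fun i hi => ?_
  by_cases hiI : i ∈ I
  · exact Submodule.mem_iSup_of_mem i (Submodule.mem_iSup_of_mem hiI ⟨hle i (hf i), h0 i hi⟩)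
  · have := hf i
    rw [iSup_neg hiI, Submodule.mem_bot] at this
    simp [this]

/-- `∑ U_i ⊗ V_j`, the sum over the pairs `(i, j)` in `I`. -/
def tfam (I : Set (ℕ × ℕ)) (𝓜 : ℕ → Submodule K M) (𝓝 : ℕ → Submodule K N) :
    Submodule K (M ⊗[K] N) :=
  ⨆ p ∈ I, tens (𝓜 p.1) (𝓝 p.2)

theorem tfam_le {I : Set (ℕ × ℕ)} {𝓜 : ℕ → Submodule K M} {𝓝 : ℕ → Submodule K N}
    {W : Submodule K (M ⊗[K] N)} :
    tfam I 𝓜 𝓝 ≤ W ↔ ∀ p ∈ I, ∀ m ∈ 𝓜 p.1, ∀ n ∈ 𝓝 p.2, m ⊗ₜ[K] n ∈ W := by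
  simp only [tfam, iSup_le_iff, tens_le]

theorem tmul_mem_tfam {I : Set (ℕ × ℕ)} {𝓜 : ℕ → Submodule K M} {𝓝 : ℕ → Submodule K N}
    {i j : ℕ} (h : (i, j) ∈ I) {m : M} {n : N} (hm : m ∈ 𝓜 i) (hn : n ∈ 𝓝 j) :
    m ⊗ₜ[K] n ∈ tfam I 𝓜 𝓝 :=
  tfam_le.1 le_rfl (i, j) h m hm n hn

theorem map_tfam {M' N' : Type*} [AddCommGroup M'] [AddCommGroup N'] [Module K M'] [Module K N']
    (f : M →ₗ[K] M') (g : N →ₗ[K] N') (I : Set (ℕ × ℕ)) (𝓜 : ℕ → Submodule K M)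
    (𝓝 : ℕ → Submodule K N) : (tfam I 𝓜 𝓝).map (TensorProduct.map f g) =
      tfam I (fun i => (𝓜 i).map f) fun i => (𝓝 i).map g := by
  simp only [tfam, Submodule.map_iSup, map_tens]

theorem tfam_ker_left (I : Set (ℕ × ℕ)) {f : M →ₗ[K] P} {𝓤 : ℕ → Submodule K M}
    {𝓟 : ℕ → Submodule K P} {𝓝 : ℕ → Submodule K N} (h𝓟 : iSupIndep 𝓟) (h𝓝 : iSupIndep 𝓝)
    (hf : ∀ i, ∀ x ∈ 𝓤 i, f x ∈ 𝓟 i) {x : M ⊗[K] N} (hx : x ∈ tfam I 𝓤 𝓝)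
    (hx0 : f.rTensor N x = 0) : x ∈ tfam I (fun i => 𝓤 i ⊓ LinearMap.ker f) 𝓝 := by
  refine iSup₂_mono (fun p _ => tens_inf_ker_left f _ _)
    (mem_biSup_inf_ker (f.rTensor N) (iSupIndep_tens h𝓟 h𝓝) (fun p => ?_) I hx hx0)
  intro y hy
  refine (?_ : tens _ _ ≤ Submodule.comap (f.rTensor N) (tens (𝓟 p.1) (𝓝 p.2))) hy
  exact tens_le.2 fun m hm n hn => tmul_mem_tens (hf _ _ hm) hn

theorem tfam_ker_right (I : Set (ℕ × ℕ)) {g : N →ₗ[K] P} {𝓜 : ℕ → Submodule K M}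
    {𝓟 : ℕ → Submodule K P} {𝓤 : ℕ → Submodule K N} (h𝓟 : iSupIndep 𝓟) (h𝓜 : iSupIndep 𝓜)
    (hg : ∀ i, ∀ x ∈ 𝓤 i, g x ∈ 𝓟 i) {x : M ⊗[K] N} (hx : x ∈ tfam I 𝓜 𝓤)
    (hx0 : g.lTensor M x = 0) : x ∈ tfam I 𝓜 (fun i => 𝓤 i ⊓ LinearMap.ker g) := by
  refine iSup₂_mono (fun p _ => tens_inf_ker_right g _ _)
    (mem_biSup_inf_ker (g.lTensor M) (iSupIndep_tens h𝓜 h𝓟) (fun p => ?_) I hx hx0)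
  intro y hy
  refine (?_ : tens _ _ ≤ Submodule.comap (g.lTensor M) (tens (𝓜 p.1) (𝓟 p.2))) hy
  exact tens_le.2 fun m hm n hn => tmul_mem_tens hm (hg _ _ hn)

end TensorFamilies

/-! ### Tensor products of modules over the tensor product of two algebras -/

section TensorModule

/-- The action of `A ⊗ B` on the tensor product of an `A`-module and a `B`-module, as an algebra
homomorphism. -/
def tensorAction (K A B M N : Type*) [Field K] [CommRing A] [CommRing B] [Algebra K A]
    [Algebra K B] [AddCommGroup M] [AddCommGroup N] [Module K M] [Module K N] [Module A M]
    [Module B N] [IsScalarTower K A M] [IsScalarTower K B N] :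
    A ⊗[K] B →ₐ[K] Module.End K (M ⊗[K] N) :=
  (Module.endTensorEndAlgHom (R := K) (S := K) (A := K) (M := M) (N := N)).comp
    (Algebra.TensorProduct.map (Algebra.lsmul K K M) (Algebra.lsmul K K N))

/-- The tensor product of an `A`-module and a `B`-module as an `A ⊗ B`-module. -/
abbrev tensorModule (K A B M N : Type*) [Field K] [CommRing A] [CommRing B] [Algebra K A]
    [Algebra K B] [AddCommGroup M] [AddCommGroup N] [Module K M] [Module K N] [Module A M]
    [Module B N] [IsScalarTower K A M] [IsScalarTower K B N] : Module (A ⊗[K] B) (M ⊗[K] N) :=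
  Module.compHom (M ⊗[K] N) (tensorAction K A B M N).toRingHom

attribute [local instance] tensorModule

variable {K A B M N : Type*} [Field K] [CommRing A] [CommRing B] [Algebra K A]
    [Algebra K B] [AddCommGroup M] [AddCommGroup N] [Module K M] [Module K N] [Module A M]
    [Module B N] [IsScalarTower K A M] [IsScalarTower K B N]

theorem tmul_smul_tmul' (a : A) (b : B) (m : M) (n : N) :
    (a ⊗ₜ[K] b) • (m ⊗ₜ[K] n) = (a • m) ⊗ₜ[K] (b • n) := rfl

theorem isScalarTower_tensorModule : IsScalarTower K (A ⊗[K] B) (M ⊗[K] N) := by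
  constructor
  intro k x y
  change tensorAction K A B M N (k • x) y = k • tensorAction K A B M N x y
  rw [map_smul, LinearMap.smul_apply]

/-- The tensor product of an `A`-linear and a `B`-linear map, as an `A ⊗ B`-linear map. -/
def tensorMap {M' N' : Type*} [AddCommGroup M'] [AddCommGroup N'] [Module K M'] [Module K N']
    [Module A M'] [Module B N'] [IsScalarTower K A M'] [IsScalarTower K B N'] (f : M →ₗ[A] M')
    (g : N →ₗ[B] N') : M ⊗[K] N →ₗ[A ⊗[K] B] M' ⊗[K] N' where
  __ := TensorProduct.map (f.restrictScalars K) (g.restrictScalars K)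
  map_smul' r x := by
    induction r with
    | zero => simp
    | add r s hr hs => simp_all [add_smul]
    | tmul a b =>
      induction x with
      | zero => simp
      | add x y hx hy => simp_all [smul_add]
      | tmul m n => simp [tmul_smul_tmul']

end TensorModule

/-! ### Resolving tensor families -/

section TensorResolution

attribute [local instance] tensorModule isScalarTower_tensorModule

section Free

variable {K A B : Type*} [Field K] [CommRing A] [CommRing B] [Algebra K A] [Algebra K B]

theorem tensorMap_tmul {M N M' N' : Type*} [AddCommGroup M] [AddCommGroup N] [Module K M]
    [Module K N] [Module A M] [Module B N] [IsScalarTower K A M] [IsScalarTower K B N]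
    [AddCommGroup M'] [AddCommGroup N'] [Module K M'] [Module K N']
    [Module A M'] [Module B N'] [IsScalarTower K A M'] [IsScalarTower K B N'] (f : M →ₗ[A] M')
    (g : N →ₗ[B] N') (m : M) (n : N) :
    tensorMap (K := K) f g (m ⊗ₜ n) = f m ⊗ₜ g n := rfl

theorem tensorMap_eq {M N M' N' : Type*} [AddCommGroup M] [AddCommGroup N] [Module K M]
    [Module K N] [Module A M] [Module B N] [IsScalarTower K A M] [IsScalarTower K B N]
    [AddCommGroup M'] [AddCommGroup N'] [Module K M'] [Module K N']
    [Module A M'] [Module B N'] [IsScalarTower K A M'] [IsScalarTower K B N'] (f : M →ₗ[A] M')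
    (g : N →ₗ[B] N') (x : M ⊗[K] N) :
    tensorMap f g x = (f.restrictScalars K).rTensor N' ((g.restrictScalars K).lTensor M x) := by
  rw [← LinearMap.comp_apply, LinearMap.rTensor_comp_lTensor]
  rfl

/-- The tensor product of two free modules is free. -/
def freeTensor (K A B : Type*) [Field K] [CommRing A] [CommRing B] [Algebra K A] [Algebra K B]
    (ι κ : Type) [Fintype ι] [Fintype κ] [DecidableEq ι] [DecidableEq κ] :
    (ι × κ → A ⊗[K] B) ≃ₗ[A ⊗[K] B] (ι → A) ⊗[K] (κ → B) where
  __ := Fintype.linearCombination (A ⊗[K] B) fun p : ι × κ =>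
    (Pi.single p.1 (1 : A) : ι → A) ⊗ₜ[K] (Pi.single p.2 (1 : B) : κ → B)
  invFun := LinearMap.pi fun p : ι × κ => TensorProduct.map
    (LinearMap.proj (R := K) (φ := fun _ : ι => A) p.1)
    (LinearMap.proj (R := K) (φ := fun _ : κ => B) p.2)
  left_inv v := by
    ext p
    simp only [AddHom.toFun_eq_coe, LinearMap.coe_toAddHom, Fintype.linearCombination_apply,
      map_sum, LinearMap.pi_apply]
    rw [Finset.sum_eq_single p]
    · induction v p with
      | zero => simp
      | add x y hx hy => rw [add_smul, map_add, hx, hy]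
      | tmul a b => simp [tmul_smul_tmul']
    · intro q _ hq
      induction v q with
      | zero => simp
      | add x y hx hy => rw [add_smul, map_add, hx, hy, add_zero]
      | tmul a b =>
        have : q.1 ≠ p.1 ∨ q.2 ≠ p.2 := by
          by_contra! h
          exact hq (Prod.ext h.1 h.2)
        obtain h | h := this
        · simp [tmul_smul_tmul', Pi.single_eq_of_ne' h]
        · simp [tmul_smul_tmul', Pi.single_eq_of_ne' h]
    · simp
  right_inv x := by
    induction x with
    | zero => simp
    | add x y hx hy => rw [map_add]; simp_all
    | tmul a b =>
      have : ∀ p : ι × κ, (a p.1 ⊗ₜ[K] b p.2) • ((Pi.single p.1 (1 : A) : ι → A) ⊗ₜ[K]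
          (Pi.single p.2 (1 : B) : κ → B)) = Pi.single p.1 (a p.1) ⊗ₜ[K] Pi.single p.2 (b p.2) := by
        intro p
        rw [tmul_smul_tmul', ← Pi.single_smul, ← Pi.single_smul, smul_eq_mul, smul_eq_mul, mul_one,
          mul_one]
      simp only [AddHom.toFun_eq_coe, LinearMap.coe_toAddHom, Fintype.linearCombination_apply,
        LinearMap.pi_apply, TensorProduct.map_tmul, LinearMap.proj_apply, this]
      rw [Fintype.sum_prod_type]
      simp_rw [← TensorProduct.tmul_sum, ← TensorProduct.sum_tmul, Finset.univ_sum_single]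

variable {ι κ : Type} [Fintype ι] [Fintype κ] [DecidableEq ι] [DecidableEq κ]

theorem freeTensor_apply (v : ι × κ → A ⊗[K] B) : freeTensor K A B ι κ v =
    Fintype.linearCombination (A ⊗[K] B) (fun p : ι × κ =>
      (Pi.single p.1 (1 : A) : ι → A) ⊗ₜ[K] (Pi.single p.2 (1 : B) : κ → B)) v := rfl

/-- Under `freeTensor`, the presentation by the products of generators becomes the tensor product of
the two presentations. This turns syzygies of `M ⊗ N` into kernels of tensor maps. -/
theorem comb_tmul {M N : Type*} [AddCommGroup M] [AddCommGroup N] [Module K M]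
    [Module K N] [Module A M] [Module B N] [IsScalarTower K A M] [IsScalarTower K B N]
    (e : ι → M) (f : κ → N) (v : ι × κ → A ⊗[K] B) :
    Fintype.linearCombination (A ⊗[K] B) (fun p : ι × κ => e p.1 ⊗ₜ[K] f p.2) v =
      tensorMap (Fintype.linearCombination A e) (Fintype.linearCombination B f)
        (freeTensor K A B ι κ v) := by
  rw [freeTensor_apply, ← comb_comp]
  have : (fun p : ι × κ => e p.1 ⊗ₜ[K] f p.2) = tensorMap (Fintype.linearCombination A e)
      (Fintype.linearCombination B f) ∘ fun p : ι × κ =>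
        (Pi.single p.1 (1 : A) : ι → A) ⊗ₜ[K] (Pi.single p.2 (1 : B) : κ → B) := by
    ext1 p
    rw [Function.comp_apply, tensorMap_tmul, Fintype.linearCombination_apply_single,
      Fintype.linearCombination_apply_single, one_smul, one_smul]
  rw [this]

variable {𝒜 : ℕ → Submodule K A} {ℬ : ℕ → Submodule K B} {I : ℕ → Set (ℕ × ℕ)}

theorem freeTensor_symm_mem {n : ℕ} {x : (ι → A) ⊗[K] (κ → B)}
    (hx : x ∈ tfam (I n) (vec 𝒜 ι) (vec ℬ κ)) :
    (freeTensor K A B ι κ).symm x ∈ vec (fun n => tfam (I n) 𝒜 ℬ) (ι × κ) n := by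
  suffices tfam (I n) (vec 𝒜 ι) (vec ℬ κ) ≤ (vec (fun n => tfam (I n) 𝒜 ℬ) (ι × κ) n).comap
      ((freeTensor K A B ι κ).symm.toLinearMap.restrictScalars K) from this hx
  refine tfam_le.2 fun p hp a ha b hb => Submodule.mem_comap.2 (mem_vec.2 fun q => ?_)
  exact tmul_mem_tfam hp (mem_vec.1 ha _) (mem_vec.1 hb _)

theorem freeTensor_mem [SetLike.GradedMonoid 𝒜] [SetLike.GradedMonoid ℬ] {n : ℕ}
    {v : ι × κ → A ⊗[K] B} (hv : v ∈ vec (fun n => tfam (I n) 𝒜 ℬ) (ι × κ) n) :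
    freeTensor K A B ι κ v ∈ tfam (I n) (vec 𝒜 ι) (vec ℬ κ) := by
  rw [freeTensor_apply, Fintype.linearCombination_apply]
  refine sum_mem fun q _ => ?_
  suffices tfam (I n) 𝒜 ℬ ≤ (tfam (I n) (vec 𝒜 ι) (vec ℬ κ)).comap
      ((LinearMap.toSpanSingleton (A ⊗[K] B) _ ((Pi.single q.1 (1 : A) : ι → A) ⊗ₜ[K]
          (Pi.single q.2 (1 : B) : κ → B))).restrictScalars K) from this (mem_vec.1 hv q)
  refine tfam_le.2 fun p hp a ha b hb => ?_
  exact tmul_mem_tfam hp (isGradedFamily_vec ι ha (single_mem_vec q.1))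
    (isGradedFamily_vec κ hb (single_mem_vec q.2))

theorem gradedMonoid_tfam [SetLike.GradedMonoid 𝒜] [SetLike.GradedMonoid ℬ] (hI0 : (0, 0) ∈ I 0)
    (hI : ∀ m n p q, p ∈ I m → q ∈ I n → p + q ∈ I (m + n)) :
    SetLike.GradedMonoid fun n => tfam (I n) 𝒜 ℬ where
  one_mem := tmul_mem_tfam hI0 SetLike.GradedOne.one_mem SetLike.GradedOne.one_mem
  mul_mem m n x y hx hy := by
    have h1 : tfam (I m) 𝒜 ℬ ≤ (tfam (I (m + n)) 𝒜 ℬ).comap (LinearMap.mulRight K y) := by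
      refine tfam_le.2 fun p hp a ha b hb => ?_
      have h2 : tfam (I n) 𝒜 ℬ ≤ (tfam (I (m + n)) 𝒜 ℬ).comap (LinearMap.mulLeft K (a ⊗ₜ b)) := by
        refine tfam_le.2 fun q hq a' ha' b' hb' => ?_
        rw [Submodule.mem_comap, LinearMap.mulLeft_apply, Algebra.TensorProduct.tmul_mul_tmul]
        exact tmul_mem_tfam (hI _ _ _ _ hp hq) (SetLike.GradedMul.mul_mem ha ha')
          (SetLike.GradedMul.mul_mem hb hb')
      exact h2 hy
    exact h1 hx

end Free

section MinGen

variable {K A B : Type*} [Field K] [CommRing A] [CommRing B] [Algebra K A] [Algebra K B]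
  {𝒜 : ℕ → Submodule K A} {ℬ : ℕ → Submodule K B} [SetLike.GradedMonoid 𝒜] [SetLike.GradedMonoid ℬ]
  {I : ℕ → Set (ℕ × ℕ)} {ι κ : Type} [Fintype ι] [Fintype κ]
  {M N : Type*} [AddCommGroup M] [AddCommGroup N] [Module K M]
  [Module K N] [Module A M] [Module B N] [IsScalarTower K A M] [IsScalarTower K B N]
  {𝓜 : ℕ → Submodule K M} {𝓝 : ℕ → Submodule K N} {e : ι → M} {f : κ → N}

omit [SetLike.GradedMonoid 𝒜] in
theorem IsMinGen.eq_map (he : IsMinGen 𝒜 𝓜 e) (i : ℕ) :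
    𝓜 i = (vec 𝒜 ι i).map ((Fintype.linearCombination A e).restrictScalars K) := by
  ext m
  rw [he.mem_iff]; rfl

omit [SetLike.GradedMonoid 𝒜] in
theorem syz_eq (e : ι → M) : syz 𝒜 e = fun i => vec 𝒜 ι (i + 1) ⊓
    LinearMap.ker ((Fintype.linearCombination A e).restrictScalars K) := rfl

omit [SetLike.GradedMonoid 𝒜] in
theorem IsMinGen.inf_ker_eq_bot (he : IsMinGen 𝒜 𝓜 e) :
    vec 𝒜 ι 0 ⊓ LinearMap.ker ((Fintype.linearCombination A e).restrictScalars K) = ⊥ :=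
  eq_bot_iff.2 fun v hv => he.eq_zero v hv.1 hv.2

/-- Generation holds because the tensor product of the two covers is surjective on each piece. For
minimality, the only pair in degree `0` is `(0, 0)`, where both covers are injective, and over a
field so is their tensor product. -/
theorem IsMinGen.tmul (hI0 : I 0 = {(0, 0)}) (he : IsMinGen 𝒜 𝓜 e) (hf : IsMinGen ℬ 𝓝 f) :
    IsMinGen (fun n => tfam (I n) 𝒜 ℬ) (fun n => tfam (I n) 𝓜 𝓝)
      (fun p : ι × κ => e p.1 ⊗ₜ[K] f p.2) := by
  classical
  constructor
  · intro i m
    have h : tfam (I i) 𝓜 𝓝 = (tfam (I i) (vec 𝒜 ι) (vec ℬ κ)).map (TensorProduct.map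
        ((Fintype.linearCombination A e).restrictScalars K)
        ((Fintype.linearCombination B f).restrictScalars K)) := by
      rw [map_tfam]
      congr 1
      · exact funext he.eq_map
      · exact funext hf.eq_map
    rw [h]
    constructor
    · rintro ⟨x, hx, rfl⟩
      refine ⟨_, freeTensor_symm_mem hx, ?_⟩
      rw [comb_tmul, LinearEquiv.apply_symm_apply]
      rfl
    · rintro ⟨v, hv, rfl⟩
      rw [comb_tmul]
      exact ⟨_, freeTensor_mem hv, rfl⟩
  · intro v hv hv0
    rw [comb_tmul, tensorMap_eq] at hv0
    have hx := freeTensor_mem hv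
    simp only [hI0, tfam, Set.mem_singleton_iff, iSup_iSup_eq_left] at hx
    have h1 : ((Fintype.linearCombination B f).restrictScalars K).lTensor (ι → A)
        (freeTensor K A B ι κ v) = 0 := by
      have := tens_inf_ker_left _ (vec 𝒜 ι 0) (𝓝 0) ⟨?_, hv0⟩
      · rwa [he.inf_ker_eq_bot, tens, Submodule.map₂_bot_left, Submodule.mem_bot] at this
      · refine (?_ : tens _ _ ≤ Submodule.comap (LinearMap.lTensor (ι → A)
          ((Fintype.linearCombination B f).restrictScalars K)) (tens (vec 𝒜 ι 0) (𝓝 0))) hx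
        exact tens_le.2 fun a ha b hb => tmul_mem_tens ha (hf.comb_mem hb)
    have := tens_inf_ker_right _ _ _ ⟨hx, h1⟩
    rw [hf.inf_ker_eq_bot, tens, Submodule.map₂_bot_right, Submodule.mem_bot] at this
    exact (freeTensor K A B ι κ).map_eq_zero_iff.1 this

omit [SetLike.GradedMonoid 𝒜] in
theorem iSupIndep_vec (h : iSupIndep 𝒜) (ι : Type) : iSupIndep (vec 𝒜 ι) := by
  rw [iSupIndep_iff_finsetSum_eq_zero_imp_eq_zero] at h ⊢
  intro s v hv hv0 i hi
  ext j
  refine h s (fun i => v i j) (fun i hi => mem_vec.1 (hv i hi) j) ?_ i hi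
  simpa using congrFun hv0 j

/-- For free covers `F → M` and `G → N`, the map `F ⊗ G → M ⊗ N` factors through `F ⊗ N`. Its kernel
is therefore an extension of `Syz M ⊗ N` by `F ⊗ Syz N`. Independence of the families makes this
compatible with the chosen set of bidegrees. The outer terms are left with unshifted factors in the
bidegrees `I (n + 1)`. -/
theorem IsMinGen.isSES_tmul [DecidableEq ι] [DecidableEq κ] (h𝒜 : iSupIndep 𝒜) (h𝓜 : iSupIndep 𝓜)
    (h𝓝 : iSupIndep 𝓝) (he : IsMinGen 𝒜 𝓜 e) (hf : IsMinGen ℬ 𝓝 f) :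
    IsSES (A := A ⊗[K] B)
      (fun n => tfam (I (n + 1)) (vec 𝒜 ι) fun j => vec ℬ κ j ⊓
        LinearMap.ker ((Fintype.linearCombination B f).restrictScalars K))
      (syz (fun n => tfam (I n) 𝒜 ℬ) fun p : ι × κ => e p.1 ⊗ₜ[K] f p.2)
      (fun n => tfam (I (n + 1)) (fun j => vec 𝒜 ι j ⊓
        LinearMap.ker ((Fintype.linearCombination A e).restrictScalars K)) 𝓝)
      (freeTensor K A B ι κ).symm.toLinearMap
      (tensorMap LinearMap.id (Fintype.linearCombination B f) ∘ₗ
        (freeTensor K A B ι κ).toLinearMap) := by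
  set φ := (Fintype.linearCombination A e).restrictScalars K with hφ
  set ψ := (Fintype.linearCombination B f).restrictScalars K with hψ
  have hle : ∀ {n x}, x ∈ tfam (I (n + 1)) (vec 𝒜 ι) (fun j => vec ℬ κ j ⊓ LinearMap.ker ψ) →
      x ∈ tfam (I (n + 1)) (vec 𝒜 ι) (vec ℬ κ) ∧ ψ.lTensor (ι → A) x = 0 := by
    intro n x hx
    refine (?_ : tfam _ _ _ ≤ tfam (I (n + 1)) (vec 𝒜 ι) (vec ℬ κ) ⊓
      LinearMap.ker (ψ.lTensor (ι → A))) hx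
    refine tfam_le.2 fun p hp a ha b hb => ⟨tmul_mem_tfam hp ha hb.1, ?_⟩
    change ψ.lTensor (ι → A) (a ⊗ₜ b) = 0
    rw [LinearMap.lTensor_tmul, hb.2, TensorProduct.tmul_zero]
  constructor
  · intro n x hx
    refine mem_syz.2 ⟨freeTensor_symm_mem (hle hx).1, ?_⟩
    rw [comb_tmul, LinearEquiv.coe_coe, LinearEquiv.apply_symm_apply, tensorMap_eq, (hle hx).2,
      map_zero]
  · intro n x _ hx
    exact (freeTensor K A B ι κ).symm.map_eq_zero_iff.1 hx
  · intro n y hy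
    rw [mem_syz, comb_tmul, tensorMap_eq] at hy
    refine tfam_ker_left (I (n + 1)) h𝓜 h𝓝 (fun i v hv => he.comb_mem hv) ?_ hy.2
    have := freeTensor_mem hy.1
    refine (?_ : tfam _ _ _ ≤ Submodule.comap (ψ.lTensor (ι → A))
      (tfam (I (n + 1)) (vec 𝒜 ι) 𝓝)) this
    exact tfam_le.2 fun p hp a ha b hb => tmul_mem_tfam hp ha (hf.comb_mem hb)
  · intro n z hz
    have h : tfam (I (n + 1)) (fun j => vec 𝒜 ι j ⊓ LinearMap.ker φ) 𝓝 =
        (tfam (I (n + 1)) (fun j => vec 𝒜 ι j ⊓ LinearMap.ker φ) (vec ℬ κ)).map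
          (TensorProduct.map LinearMap.id ψ) := by
      rw [map_tfam]
      congr 1
      · simp
      · exact funext hf.eq_map
    rw [h] at hz
    obtain ⟨x, hx, rfl⟩ := hz
    have hx' : x ∈ tfam (I (n + 1)) (vec 𝒜 ι) (vec ℬ κ) ∧ φ.rTensor (κ → B) x = 0 := by
      refine (?_ : tfam _ _ _ ≤ tfam (I (n + 1)) (vec 𝒜 ι) (vec ℬ κ) ⊓
        LinearMap.ker (φ.rTensor (κ → B))) hx
      refine tfam_le.2 fun p hp a ha b hb => ⟨tmul_mem_tfam hp ha.1 hb, ?_⟩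
      change φ.rTensor (κ → B) (a ⊗ₜ b) = 0
      rw [LinearMap.rTensor_tmul, ha.2, TensorProduct.zero_tmul]
    refine ⟨(freeTensor K A B ι κ).symm x, mem_syz.2 ⟨freeTensor_symm_mem hx'.1, ?_⟩, ?_⟩
    -- The two factor maps commute, so the vanishing of `φ ⊗ 1` on `x` kills the composite as well.
    · rw [comb_tmul, LinearEquiv.apply_symm_apply, tensorMap_eq, ← LinearMap.comp_apply,
        LinearMap.rTensor_comp_lTensor, ← LinearMap.lTensor_comp_rTensor, LinearMap.comp_apply,
        hx'.2, map_zero]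
    · rw [LinearMap.comp_apply, LinearEquiv.coe_coe, LinearEquiv.apply_symm_apply]
      rfl
  · intro n x hx
    rw [LinearMap.comp_apply, LinearEquiv.coe_coe, LinearEquiv.coe_coe,
      LinearEquiv.apply_symm_apply]
    exact (hle hx).2
  · intro n y hy hy0
    rw [mem_syz] at hy
    exact ⟨freeTensor K A B ι κ y, tfam_ker_right (I (n + 1)) h𝓝 (iSupIndep_vec h𝒜 ι)
      (fun i v hv => hf.comb_mem hv) (freeTensor_mem hy.1) hy0, LinearEquiv.symm_apply_apply _ _⟩

end MinGen

theorem hasLinRes_vec {K : Type*} {A : Type u} [Field K] [CommRing A] [Algebra K A]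
    (𝒜 : ℕ → Submodule K A) [SetLike.GradedMonoid 𝒜] (ι : Type) [Fintype ι] :
    HasLinRes 𝒜 (vec 𝒜 ι) := by
  classical
  refine HasLinRes.of_minGen (e := fun j => Pi.single j 1)
    ⟨fun i m => ?_, fun v hv hv0 => by rwa [comb_single] at hv0⟩ (HasLinRes.of_eq_bot fun i => ?_)
  · simp_rw [comb_single]
    exact ⟨fun h => ⟨m, h, rfl⟩, fun ⟨_, h, h'⟩ => h' ▸ h⟩
  · refine eq_bot_iff.2 fun v hv => ?_
    rw [mem_syz, comb_single] at hv
    exact hv.2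

/-! ### Closure under syzygies of iterated extensions of tensor families -/

section Class

variable {K : Type w} {A : Type u} {B : Type v} [Field K] [CommRing A] [CommRing B] [Algebra K A]
  [Algebra K B]

/-- The iterated extensions of families `∑ U_i ⊗ V_j`. -/
inductive TensorClass (𝒜 : ℕ → Submodule K A) (ℬ : ℕ → Submodule K B) (I : ℕ → Set (ℕ × ℕ)) :
    ∀ (T : Type max u v) [AddCommGroup T] [Module K T] [Module (A ⊗[K] B) T]
      [IsScalarTower K (A ⊗[K] B) T], (ℕ → Submodule K T) → Prop
  | tensor {M : Type u} {N : Type v} [AddCommGroup M] [AddCommGroup N] [Module K M] [Module K N]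
      [Module A M] [Module B N] [IsScalarTower K A M] [IsScalarTower K B N]
      {𝓜 : ℕ → Submodule K M} {𝓝 : ℕ → Submodule K N} (h𝓜 : HasLinRes 𝒜 𝓜) (h𝓝 : HasLinRes ℬ 𝓝)
      (i𝓜 : iSupIndep 𝓜) (i𝓝 : iSupIndep 𝓝) :
      TensorClass 𝒜 ℬ I (M ⊗[K] N) fun n => tfam (I n) 𝓜 𝓝
  | extension {M₁ M₂ M₃ : Type max u v} [AddCommGroup M₁] [AddCommGroup M₂] [AddCommGroup M₃]
      [Module K M₁] [Module K M₂] [Module K M₃] [Module (A ⊗[K] B) M₁] [Module (A ⊗[K] B) M₂]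
      [Module (A ⊗[K] B) M₃] [IsScalarTower K (A ⊗[K] B) M₁] [IsScalarTower K (A ⊗[K] B) M₂]
      [IsScalarTower K (A ⊗[K] B) M₃]
      {𝓧 : ℕ → Submodule K M₁} {𝓨 : ℕ → Submodule K M₂} {𝓩 : ℕ → Submodule K M₃}
      {f : M₁ →ₗ[A ⊗[K] B] M₂} {g : M₂ →ₗ[A ⊗[K] B] M₃} (h : IsSES 𝓧 𝓨 𝓩 f g)
      (h𝓨 : IsGradedFamily (fun n => tfam (I n) 𝒜 ℬ) 𝓨) (hX : TensorClass 𝒜 ℬ I M₁ 𝓧)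
      (hZ : TensorClass 𝒜 ℬ I M₃ 𝓩) : TensorClass 𝒜 ℬ I M₂ 𝓨

variable {𝒜 : ℕ → Submodule K A} {ℬ : ℕ → Submodule K B} [SetLike.GradedMonoid 𝒜]
  [SetLike.GradedMonoid ℬ] {I : ℕ → Set (ℕ × ℕ)}

/-- Syzygies of a tensor family are extensions of tensor families, and by the horseshoe argument
syzygies of an extension are extensions of syzygies; hence `TensorClass` is closed. The hypotheses
`hleft` and `hright` isolate what depends on the grading: how a tensor family with a factor
vanishing in degree `0` is re-indexed after dropping one total or diagonal degree. -/
theorem HasLinRes.tensor (hI0 : I 0 = {(0, 0)})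
    (hI : ∀ m n p q, p ∈ I m → q ∈ I n → p + q ∈ I (m + n))
    (h𝒜 : iSupIndep 𝒜) (hℬ : iSupIndep ℬ)
    (hleft : ∀ {M : Type u} {N : Type v} [AddCommGroup M] [AddCommGroup N] [Module K M] [Module K N]
      [Module A M] [Module B N] [IsScalarTower K A M] [IsScalarTower K B N]
      (𝓜 : ℕ → Submodule K M) (𝓝 : ℕ → Submodule K N), 𝓜 0 = ⊥ →
      HasLinRes 𝒜 (fun n => 𝓜 (n + 1)) → HasLinRes ℬ 𝓝 →
      ∃ p q : ℕ, HasLinRes 𝒜 (fun n => 𝓜 (n + p)) ∧ HasLinRes ℬ (fun n => 𝓝 (n + q)) ∧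
        ∀ n, tfam (I (n + 1)) 𝓜 𝓝 = tfam (I n) (fun n => 𝓜 (n + p)) (fun n => 𝓝 (n + q)))
    (hright : ∀ {M : Type u} {N : Type v} [AddCommGroup M] [AddCommGroup N] [Module K M]
      [Module K N] [Module A M] [Module B N] [IsScalarTower K A M] [IsScalarTower K B N]
      (𝓜 : ℕ → Submodule K M) (𝓝 : ℕ → Submodule K N), 𝓝 0 = ⊥ →
      HasLinRes 𝒜 𝓜 → HasLinRes ℬ (fun n => 𝓝 (n + 1)) →
      ∃ p q : ℕ, HasLinRes 𝒜 (fun n => 𝓜 (n + p)) ∧ HasLinRes ℬ (fun n => 𝓝 (n + q)) ∧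
        ∀ n, tfam (I (n + 1)) 𝓜 𝓝 = tfam (I n) (fun n => 𝓜 (n + p)) (fun n => 𝓝 (n + q)))
    {M : Type u} {N : Type v} [AddCommGroup M] [AddCommGroup N] [Module K M]
    [Module K N] [Module A M] [Module B N] [IsScalarTower K A M] [IsScalarTower K B N]
    {𝓜 : ℕ → Submodule K M} {𝓝 : ℕ → Submodule K N} (h𝓜 : HasLinRes 𝒜 𝓜) (h𝓝 : HasLinRes ℬ 𝓝)
    (i𝓜 : iSupIndep 𝓜) (i𝓝 : iSupIndep 𝓝) :
    HasLinRes (fun n => tfam (I n) 𝒜 ℬ) fun n => tfam (I n) 𝓜 𝓝 := by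
  classical
  have : SetLike.GradedMonoid fun n => tfam (I n) 𝒜 ℬ :=
    gradedMonoid_tfam (by rw [hI0]; rfl) hI
  refine HasLinRes.coinduct (fun T _ _ _ _ 𝓧 => TensorClass 𝒜 ℬ I T 𝓧) ?_
    (TensorClass.tensor h𝓜 h𝓝 i𝓜 i𝓝)
  intro T _ _ _ _ 𝓧 h
  induction h with
  | @tensor M N _ _ _ _ _ _ _ _ 𝓜 𝓝 h𝓜 h𝓝 i𝓜 i𝓝 =>
    obtain ⟨ι, _, e, he, h𝓜'⟩ := h𝓜.exists_minGen
    obtain ⟨κ, _, f, hf, h𝓝'⟩ := h𝓝.exists_minGen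
    rw [syz_eq] at h𝓜' h𝓝'
    obtain ⟨p, q, h1, h2, h3⟩ := hright (vec 𝒜 ι) (fun j => vec ℬ κ j ⊓
      LinearMap.ker ((Fintype.linearCombination B f).restrictScalars K)) hf.inf_ker_eq_bot (hasLinRes_vec 𝒜 ι) h𝓝'
    obtain ⟨p', q', h1', h2', h3'⟩ := hleft (fun j => vec 𝒜 ι j ⊓
      LinearMap.ker ((Fintype.linearCombination A e).restrictScalars K)) 𝓝 he.inf_ker_eq_bot h𝓜' h𝓝
    have hS := he.isSES_tmul (I := I) h𝒜 i𝓜 i𝓝 hf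
    -- Minimality makes the syzygy factors vanish in degree `0`, so both outer terms can be
    -- rewritten as tensor families of shifted factors.
    simp only [h3, h3'] at hS
    refine ⟨ι × κ, inferInstance, _, he.tmul hI0 hf, TensorClass.extension hS
      (isGradedFamily_syz _) (TensorClass.tensor h1 h2 ?_ ?_) (TensorClass.tensor h1' h2' ?_ ?_)⟩
    · exact (iSupIndep_vec h𝒜 ι).comp (add_left_injective p)
    · exact ((iSupIndep_vec hℬ κ).mono fun i => inf_le_left).comp (add_left_injective q)
    · exact ((iSupIndep_vec h𝒜 ι).mono fun i => inf_le_left).comp (add_left_injective p')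
    · exact i𝓝.comp (add_left_injective q')
  | extension h h𝓨 _ _ ihX ihZ =>
    obtain ⟨ι, _, eX, heX, hX⟩ := ihX
    obtain ⟨κ, _, eZ, heZ, hZ⟩ := ihZ
    obtain ⟨eY, heY, hY⟩ := h.exists_minGen h𝓨 heX heZ
    exact ⟨_, inferInstance, eY, heY, TensorClass.extension hY (isGradedFamily_syz _) hX hZ⟩

theorem HasLinRes.totalTensor (h𝒜 : iSupIndep 𝒜) (hℬ : iSupIndep ℬ)
    {M : Type u} {N : Type v} [AddCommGroup M] [AddCommGroup N] [Module K M]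
    [Module K N] [Module A M] [Module B N] [IsScalarTower K A M] [IsScalarTower K B N]
    {𝓜 : ℕ → Submodule K M} {𝓝 : ℕ → Submodule K N} (h𝓜 : HasLinRes 𝒜 𝓜) (h𝓝 : HasLinRes ℬ 𝓝)
    (i𝓜 : iSupIndep 𝓜) (i𝓝 : iSupIndep 𝓝) :
    HasLinRes (fun n => tfam {p | p.1 + p.2 = n} 𝒜 ℬ) fun n => tfam {p | p.1 + p.2 = n} 𝓜 𝓝 := by
  refine HasLinRes.tensor (I := fun n => {p | p.1 + p.2 = n}) ?_ ?_ h𝒜 hℬ ?_ ?_ h𝓜 h𝓝 i𝓜 i𝓝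
  · ext ⟨i, j⟩; simp
  · rintro _ _ ⟨i, j⟩ ⟨i', j'⟩ rfl rfl
    simp; ring
  · intro M N _ _ _ _ _ _ _ _ 𝓜 𝓝 h0 h𝓜 h𝓝
    -- Only the vanishing factor is shifted: pairs `(0, n + 1)` contribute nothing, and the others
    -- are `(i + 1, j)` with `i + j = n`.
    refine ⟨1, 0, h𝓜, h𝓝, fun n => le_antisymm (tfam_le.2 ?_) (tfam_le.2 ?_)⟩
    · rintro ⟨_ | i, j⟩ hp x hx y hy
      · rw [h0, Submodule.mem_bot] at hx
        simp [hx]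
      · exact tmul_mem_tfam (i := i) (j := j) (by simp at hp ⊢; lia) hx hy
    · rintro ⟨i, j⟩ hp x hx y hy
      exact tmul_mem_tfam (i := i + 1) (j := j) (by simp at hp ⊢; lia) hx hy
  · intro M N _ _ _ _ _ _ _ _ 𝓜 𝓝 h0 h𝓜 h𝓝
    refine ⟨0, 1, h𝓜, h𝓝, fun n => le_antisymm (tfam_le.2 ?_) (tfam_le.2 ?_)⟩
    · rintro ⟨i, _ | j⟩ hp x hx y hy
      · rw [h0, Submodule.mem_bot] at hy
        simp [hy]
      · exact tmul_mem_tfam (i := i) (j := j) (by simp at hp ⊢; lia) hx hy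
    · rintro ⟨i, j⟩ hp x hx y hy
      exact tmul_mem_tfam (i := i) (j := j + 1) (by simp at hp ⊢; lia) hx hy

theorem HasLinRes.diagonalTensor (h𝒜 : iSupIndep 𝒜) (hℬ : iSupIndep ℬ)
    (hA0 : ∀ a ∈ 𝒜 0, ∃ c : K, algebraMap K A c = a) (hA : HasLinRes 𝒜 fun i => 𝒜 (i + 1))
    (hB0 : ∀ a ∈ ℬ 0, ∃ c : K, algebraMap K B c = a) (hB : HasLinRes ℬ fun i => ℬ (i + 1))
    {M : Type u} {N : Type v} [AddCommGroup M] [AddCommGroup N] [Module K M]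
    [Module K N] [Module A M] [Module B N] [IsScalarTower K A M] [IsScalarTower K B N]
    {𝓜 : ℕ → Submodule K M} {𝓝 : ℕ → Submodule K N} (h𝓜 : HasLinRes 𝒜 𝓜) (h𝓝 : HasLinRes ℬ 𝓝)
    (i𝓜 : iSupIndep 𝓜) (i𝓝 : iSupIndep 𝓝) :
    HasLinRes (fun n => tfam {(n, n)} 𝒜 ℬ) fun n => tfam {(n, n)} 𝓜 𝓝 := by
  refine HasLinRes.tensor (I := fun n => {(n, n)}) rfl ?_ h𝒜 hℬ ?_ ?_ h𝓜 h𝓝 i𝓜 i𝓝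
  · rintro _ _ _ _ rfl rfl
    rfl
  · intro M N _ _ _ _ _ _ _ _ 𝓜 𝓝 h0 h𝓜 h𝓝
    -- On the diagonal both factors move together; truncating the factor that is not a syzygy module
    -- is where the Koszul property enters.
    exact ⟨1, 1, h𝓜, HasLinRes.shift_one hB0 hB h𝓝, fun n => by simp [tfam]⟩
  · intro M N _ _ _ _ _ _ _ _ 𝓜 𝓝 h0 h𝓜 h𝓝
    exact ⟨1, 1, HasLinRes.shift_one hA0 hA h𝓜, h𝓝, fun n => by simp [tfam]⟩

end Class

end TensorResolution

/-! ### The residue field: linear free resolutions versus minimal syzygies -/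

section Residue

variable {K : Type*} {A : Type u} [Field K] [CommRing A] [Algebra K A] {𝒜 : ℕ → Submodule K A}

/-- The grading of the residue class field, concentrated in degree `0`. -/
def residueGrading (𝒜 : ℕ → Submodule K A) (n : ℕ) : Submodule K (ResidueField 𝒜) :=
  if n = 0 then ⊤ else ⊥

theorem iSupIndep_residueGrading (𝒜 : ℕ → Submodule K A) : iSupIndep (residueGrading 𝒜) := by
  rintro (_ | i)
  · refine disjoint_bot_right.mono_right (iSup₂_le fun j hj => ?_)
    simp [residueGrading, hj]
  · simp [residueGrading]

/-- A module with one generator and nothing in positive degrees has all of the positive-degree part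
of the ring as its syzygies. -/
theorem HasLinRes.augmentationIdeal [SetLike.GradedMonoid 𝒜] {M : Type*} [AddCommGroup M]
    [Module K M] [Module A M] {𝓜 : ℕ → Submodule K M} (h : HasLinRes 𝒜 𝓜) {ι : Type} [Fintype ι]
    [Unique ι] {e : ι → M} (he : IsMinGen 𝒜 𝓜 e) (h𝓜 : ∀ n, 𝓜 (n + 1) = ⊥) :
    HasLinRes 𝒜 fun n => 𝒜 (n + 1) := by
  refine HasLinRes.of_iso (LinearMap.proj (default : ι)) (fun i x _ hx => ?_) (fun i y => ?_)
    (h.syz_of_minGen he)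
  · ext j
    rw [Unique.eq_default j]
    exact hx
  · constructor
    · intro hy
      have hv : (fun _ => y) ∈ KoszulAlg.vec 𝒜 ι (i + 1) := mem_vec.2 fun _ => hy
      refine ⟨fun _ => y, mem_syz.2 ⟨hv, ?_⟩, rfl⟩
      have := he.comb_mem hv
      rwa [h𝓜, Submodule.mem_bot] at this
    · rintro ⟨x, hx, rfl⟩
      exact mem_vec.1 (mem_syz.1 hx).1 _

theorem HasLinRes.of_augmentationIdeal [SetLike.GradedMonoid 𝒜] {M : Type*} [AddCommGroup M]
    [Module K M] [Module A M] {𝓜 : ℕ → Submodule K M} {ι : Type} [Fintype ι]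
    [Unique ι] {e : ι → M} (he : IsMinGen 𝒜 𝓜 e) (h𝓜 : ∀ n, 𝓜 (n + 1) = ⊥)
    (h : HasLinRes 𝒜 fun n => 𝒜 (n + 1)) : HasLinRes 𝒜 𝓜 := by
  refine HasLinRes.of_minGen he (HasLinRes.of_iso
    (LinearMap.pi fun _ => LinearMap.id : A →ₗ[A] ι → A) (fun i x _ hx => ?_) (fun i y => ?_) h)
  · exact congrFun hx default
  · constructor
    · intro hy
      refine ⟨y default, mem_vec.1 (mem_syz.1 hy).1 _, ?_⟩
      ext j
      rw [Unique.eq_default j]; rfl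
    · rintro ⟨x, hx, rfl⟩
      have hv : (fun _ => x) ∈ KoszulAlg.vec 𝒜 ι (i + 1) := mem_vec.2 fun _ => hx
      refine mem_syz.2 ⟨hv, ?_⟩
      have := he.comb_mem hv
      rwa [h𝓜, Submodule.mem_bot] at this

variable [GradedAlgebra 𝒜]

variable (𝒜) in
/-- The homogeneous component of degree `n` of a vector. -/
def component {ι : Type} (n : ℕ) (v : ι → A) : ι → A :=
  fun k => DirectSum.decompose 𝒜 (v k) n

theorem component_mem {ι : Type} (n : ℕ) (v : ι → A) : component 𝒜 n v ∈ vec 𝒜 ι n :=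
  mem_vec.2 fun _ => SetLike.coe_mem _

theorem component_of_mem {ι : Type} {n : ℕ} {v : ι → A} (hv : v ∈ vec 𝒜 ι n) :
    component 𝒜 n v = v :=
  funext fun k => DirectSum.decompose_of_mem_same 𝒜 (mem_vec.1 hv k)

theorem component_zero {ι : Type} (n : ℕ) : component 𝒜 n (0 : ι → A) = 0 := by
  ext k; simp [component]

theorem mem_of_component_mem {ι : Type} [Fintype ι] (S : AddSubgroup (ι → A)) {v : ι → A}
    (h : ∀ n, component 𝒜 n v ∈ S) : v ∈ S := by
  classical
  have : v = ∑ n ∈ Finset.univ.biUnion fun k => (DirectSum.decompose 𝒜 (v k)).support,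
      component 𝒜 n v := by
    ext k
    rw [Finset.sum_apply]
    conv_lhs => rw [← DirectSum.sum_support_decompose 𝒜 (v k)]
    refine Finset.sum_subset (Finset.subset_biUnion_of_mem
      (fun k => (DirectSum.decompose 𝒜 (v k)).support) (Finset.mem_univ k)) fun n _ hn => ?_
    simpa using hn
  rw [this]
  exact sum_mem fun n _ => h n

theorem component_succ_comb {ι κ : Type} [Fintype κ] {D : κ → ι → A} (hD : ∀ k, D k ∈ vec 𝒜 ι 1)
    (n : ℕ) (w : κ → A) : component 𝒜 (n + 1) (Fintype.linearCombination A D w) =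
      Fintype.linearCombination A D (component 𝒜 n w) := by
  ext j
  simp only [component, Fintype.linearCombination_apply, Finset.sum_apply, Pi.smul_apply,
    smul_eq_mul, ← GradedRing.proj_apply, map_sum]
  exact Finset.sum_congr rfl fun k _ =>
    DirectSum.coe_decompose_mul_add_of_right_mem 𝒜 (mem_vec.1 (hD k) j)

theorem component_zero_comb {ι κ : Type} [Fintype κ] {D : κ → ι → A} (hD : ∀ k, D k ∈ vec 𝒜 ι 1)
    (w : κ → A) : component 𝒜 0 (Fintype.linearCombination A D w) = 0 := by
  ext j
  simp only [component, Fintype.linearCombination_apply, Finset.sum_apply, Pi.smul_apply,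
    smul_eq_mul, ← GradedRing.proj_apply, map_sum]
  exact Finset.sum_eq_zero fun k _ =>
    DirectSum.coe_decompose_mul_of_right_mem_of_not_le 𝒜 (mem_vec.1 (hD k) j) (by simp)

theorem mem_gradedMaximalIdeal_iff {a : A} :
    a ∈ gradedMaximalIdeal 𝒜 ↔ (DirectSum.decompose 𝒜 a 0 : A) = 0 := by
  classical
  constructor
  · intro ha
    have : gradedMaximalIdeal 𝒜 ≤ RingHom.ker (GradedRing.projZeroRingHom 𝒜) := by
      refine Ideal.span_le.2 ?_
      rintro x ⟨i, hi, hx⟩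
      exact DirectSum.decompose_of_mem_ne 𝒜 hx hi.ne'
    exact this ha
  · intro ha
    rw [← DirectSum.sum_support_decompose 𝒜 a]
    refine sum_mem fun i hi => Ideal.subset_span ⟨i, Nat.pos_of_ne_zero ?_, SetLike.coe_mem _⟩
    rintro rfl
    simp_all

theorem comb_residue_eq_zero {ι : Type} [Fintype ι] (e : ι → ResidueField 𝒜) {v : ι → A}
    (hv : component 𝒜 0 v = 0) : Fintype.linearCombination A e v = 0 := by
  rw [Fintype.linearCombination_apply]
  refine Finset.sum_eq_zero fun k _ => ?_
  obtain ⟨a, ha⟩ := Ideal.Quotient.mk_surjective (e k)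
  rw [← ha]
  exact Ideal.Quotient.eq_zero_iff_mem.2
    (Ideal.mul_mem_right _ _ (mem_gradedMaximalIdeal_iff.2 (congrFun hv k)))

theorem comb_residue_component_zero {ι : Type} [Fintype ι] (e : ι → ResidueField 𝒜) (v : ι → A) :
    Fintype.linearCombination A e (component 𝒜 0 v) = Fintype.linearCombination A e v := by
  rw [eq_comm, ← sub_eq_zero, ← map_sub]
  refine comb_residue_eq_zero e (funext fun k => ?_)
  simp [component, DirectSum.decompose_sub]

theorem component_zero_of_mem_succ {ι : Type} {n : ℕ} {v : ι → A} (hv : v ∈ vec 𝒜 ι (n + 1)) :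
    component 𝒜 0 v = 0 :=
  funext fun k => DirectSum.decompose_of_mem_ne 𝒜 (mem_vec.1 hv k) n.succ_ne_zero

/-- Positive-degree coefficients act as zero on the residue field, so only the degree `0` component
of a coefficient vector counts. -/
theorem isMinGen_residue_iff {ι : Type} [Fintype ι] {e : ι → ResidueField 𝒜} :
    IsMinGen 𝒜 (residueGrading 𝒜) e ↔ Function.Surjective (Fintype.linearCombination A e) ∧
      ∀ v ∈ vec 𝒜 ι 0, Fintype.linearCombination A e v = 0 → v = 0 := by
  refine ⟨fun h => ⟨fun y => ?_, h.eq_zero⟩, fun h => ⟨fun i m => ?_, h.2⟩⟩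
  · obtain ⟨v, -, hv⟩ := (h.mem_iff 0 y).1 (by simp [residueGrading])
    exact ⟨v, hv⟩
  · obtain _ | i := i
    · obtain ⟨v, rfl⟩ := h.1 m
      exact ⟨fun _ => ⟨_, component_mem 0 v, comb_residue_component_zero e v⟩,
        fun _ => by simp [residueGrading]⟩
    · simp only [residueGrading, i.succ_ne_zero, if_false, Submodule.mem_bot]
      constructor
      · rintro rfl
        exact ⟨0, zero_mem _, map_zero _⟩
      · rintro ⟨v, hv, rfl⟩
        exact comb_residue_eq_zero e (component_zero_of_mem_succ hv)

variable (𝒜) in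
theorem isMinGen_residue_one (ι : Type) [Fintype ι] [Unique ι] :
    IsMinGen 𝒜 (residueGrading 𝒜) fun _ : ι => (1 : ResidueField 𝒜) := by
  have h : ∀ v : ι → A, Fintype.linearCombination A (fun _ : ι => (1 : ResidueField 𝒜)) v =
      Ideal.Quotient.mk _ (v default) := fun v => by
    rw [Fintype.linearCombination_apply, Fintype.sum_unique, Algebra.smul_def, mul_one]
    rfl
  rw [isMinGen_residue_iff]
  refine ⟨fun y => ?_, fun v hv hv0 => ?_⟩
  · obtain ⟨a, rfl⟩ := Ideal.Quotient.mk_surjective y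
    exact ⟨fun _ => a, h _⟩
  · rw [h, Ideal.Quotient.eq_zero_iff_mem, mem_gradedMaximalIdeal_iff] at hv0
    ext k
    rw [Unique.eq_default k, ← DirectSum.decompose_of_mem_same 𝒜 (mem_vec.1 hv default), hv0]
    rfl

/-- Generation follows by taking homogeneous components of a preimage. Minimality comes from the
next map: a degree `0` relation lies in the image of `D'`, whose entries have degree `1`, so it
vanishes. -/
theorem isMinGen_of_exact {ι κ τ : Type} [Fintype ι] [Fintype κ] [Fintype τ] {M : Type*}
    [AddCommGroup M] [Module A M] {e : ι → M} {D : κ → ι → A} {D' : τ → κ → A}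
    (hD : ∀ k, D k ∈ vec 𝒜 ι 1) (hD' : ∀ k, D' k ∈ vec 𝒜 κ 1)
    (h : Function.Exact (Fintype.linearCombination A D) (Fintype.linearCombination A e))
    (h' : Function.Exact (Fintype.linearCombination A D') (Fintype.linearCombination A D)) :
    IsMinGen 𝒜 (syz 𝒜 e) D := by
  constructor
  · intro i v
    rw [mem_syz]
    constructor
    · rintro ⟨hv, hv0⟩
      obtain ⟨w, rfl⟩ := (h v).1 hv0
      exact ⟨_, component_mem i w, by rw [← component_succ_comb hD, component_of_mem hv]⟩
    · rintro ⟨w, hw, rfl⟩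
      exact ⟨comb_mem_vec hD hw, (h _).2 ⟨w, rfl⟩⟩
  · intro w hw hw0
    obtain ⟨u, rfl⟩ := (h' w).1 hw0
    rw [← component_of_mem hw, component_zero_comb hD']

/-- Exactness is checked component by component. Since `M` carries no grading here, `hc` replaces
homogeneity of the map; the degree `0` component is zero by minimality, and the others are generated
by `D`. -/
theorem exact_of_isMinGen {ι κ : Type} [Fintype ι] [Fintype κ] {M : Type*}
    [AddCommGroup M] [Module A M] {e : ι → M} {D : κ → ι → A} (hD : IsMinGen 𝒜 (syz 𝒜 e) D)
    (he : ∀ v ∈ vec 𝒜 ι 0, Fintype.linearCombination A e v = 0 → v = 0)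
    (hc : ∀ n v, Fintype.linearCombination A e v = 0 →
      Fintype.linearCombination A e (component 𝒜 n v) = 0) :
    Function.Exact (Fintype.linearCombination A D) (Fintype.linearCombination A e) := by
  intro v
  constructor
  · intro hv
    refine mem_of_component_mem (𝒜 := 𝒜)
      (LinearMap.range (Fintype.linearCombination A D)).toAddSubgroup fun n => ?_
    obtain _ | n := n
    · rw [he _ (component_mem 0 v) (hc 0 v hv)]
      exact zero_mem _
    · obtain ⟨w, -, hw⟩ := (hD.mem_iff n _).1
        (mem_syz.2 ⟨component_mem (n + 1) v, hc (n + 1) v hv⟩)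
      exact ⟨w, hw⟩
  · rintro ⟨w, rfl⟩
    rw [← comb_comb, Fintype.linearCombination_apply]
    exact Finset.sum_eq_zero fun k _ => by
      rw [(mem_syz.1 (hD.mem k)).2, smul_zero]

theorem LinearFreeResolution.hasLinRes (L : LinearFreeResolution 𝒜) :
    HasLinRes 𝒜 (residueGrading 𝒜) := by
  classical
  have h : ∀ {n : ℕ} {M : Type u} [AddCommGroup M] [Module A M] (f : (Fin n → A) →ₗ[A] M),
      (Fintype.linearCombination A fun j => f (Pi.single j 1)) = f := fun f => by
    refine LinearMap.ext fun v => ?_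
    exact (comb_comp f (fun j => Pi.single j 1) v).trans (by rw [comb_single])
  have hD : ∀ i j, L.d i (Pi.single j 1) ∈ vec 𝒜 (Fin (L.rank i)) 1 := fun i j =>
    mem_vec.2 (L.d_degree i 0 _ (mem_vec.1 (single_mem_vec j)))
  refine ⟨fun n => Fin (L.rank n), fun _ => inferInstance, fun j => L.ε (Pi.single j 1),
    fun n j => L.d n (Pi.single j 1), ?_, ?_, fun n => ?_⟩
  · rw [isMinGen_residue_iff, h]
    refine ⟨L.ε_surjective, fun v hv hv0 => ?_⟩
    obtain ⟨u, rfl⟩ := (L.exact_zero v).1 hv0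
    rw [← component_of_mem hv, ← h (L.d 0), component_zero_comb (hD 0)]
  · refine isMinGen_of_exact (hD 0) (hD 1) ?_ ?_
    · rw [h, h]; exact L.exact_zero
    · rw [h, h]; exact L.exact_succ 0
  · refine isMinGen_of_exact (hD (n + 1)) (hD (n + 2)) ?_ ?_
    · rw [h, h]; exact L.exact_succ n
    · rw [h, h]; exact L.exact_succ (n + 1)

theorem exact_conj {ι κ τ σ M : Type*} [AddCommGroup M] [Module A M] {f : (κ → A) →ₗ[A] (ι → A)}
    {g : (ι → A) →ₗ[A] M} (h : Function.Exact f g) (a : (τ → A) ≃ₗ[A] (κ → A))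
    (b : (σ → A) ≃ₗ[A] (ι → A)) :
    Function.Exact (b.symm.toLinearMap ∘ₗ f ∘ₗ a.toLinearMap) (g ∘ₗ b.toLinearMap) := by
  intro y
  rw [LinearMap.comp_apply, LinearEquiv.coe_coe, h]
  constructor
  · rintro ⟨x, hx⟩
    exact ⟨a.symm x, by simp [hx]⟩
  · rintro ⟨x, rfl⟩
    exact ⟨a x, by simp⟩

theorem HasLinRes.nonempty_linearFreeResolution (h : HasLinRes 𝒜 (residueGrading 𝒜)) :
    Nonempty (LinearFreeResolution 𝒜) := by
  obtain ⟨ι, _, e₀, e, h₀, h₁, h₂⟩ := h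
  have hD : ∀ n k, e n k ∈ KoszulAlg.vec 𝒜 (ι n) 1 := by
    rintro (_ | n) k
    · exact (mem_syz.1 (h₁.mem k)).1
    · exact (mem_syz.1 ((h₂ n).mem k)).1
  have hz : ∀ n, ∀ v ∈ KoszulAlg.vec 𝒜 (ι (n + 1)) 0,
      Fintype.linearCombination A (e n) v = 0 → v = 0 := by
    rintro (_ | n)
    · exact h₁.eq_zero
    · exact (h₂ n).eq_zero
  have hex₀ : Function.Exact (Fintype.linearCombination A (e 0))
      (Fintype.linearCombination A e₀) := by
    refine exact_of_isMinGen h₁ h₀.eq_zero ?_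
    rintro (_ | n) v hv
    · rw [comb_residue_component_zero, hv]
    · exact comb_residue_eq_zero _ (component_zero_of_mem_succ (component_mem _ _))
  have hex : ∀ n, Function.Exact (Fintype.linearCombination A (e (n + 1)))
      (Fintype.linearCombination A (e n)) := fun n => by
    refine exact_of_isMinGen (h₂ n) (hz n) fun m v hv => ?_
    rw [← component_succ_comb (hD n), hv, component_zero]
  let u : ∀ n, (Fin (Fintype.card (ι n)) → A) ≃ₗ[A] (ι n → A) := fun n =>
    LinearEquiv.funCongrLeft A A (Fintype.equivFin (ι n))
  exact ⟨{
    rank := fun n => Fintype.card (ι n)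
    d := fun n => (u n).symm.toLinearMap ∘ₗ Fintype.linearCombination A (e n) ∘ₗ
      (u (n + 1)).toLinearMap
    ε := Fintype.linearCombination A e₀ ∘ₗ (u 0).toLinearMap
    d_degree := fun i n v hv k =>
      mem_vec.1 (comb_mem_vec (hD i) (v := u (i + 1) v) (mem_vec.2 fun j => hv _)) _
    ε_surjective := (isMinGen_residue_iff.1 h₀).1.comp (u 0).surjective
    exact_zero := exact_conj hex₀ _ _
    exact_succ := fun i y => by
      rw [← exact_conj (hex i) (u (i + 2)) (u (i + 1)) y]
      simp }⟩

end Residue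

/-! ### Transport to a subalgebra -/

section Transport

variable {K : Type*} {S : Type u} {R : Type v} [Field K] [CommRing S] [CommRing R] [Algebra K S]
  [Algebra K R] {𝒮 : ℕ → Submodule K S} {𝒞 : ℕ → Submodule K R} [SetLike.GradedMonoid 𝒮]
  [SetLike.GradedMonoid 𝒞]

/-- All coefficients of the resolution over `R` lie in the pieces `𝒞 i`, which are the images of the
`𝒮 i`. Generators and relations therefore lift uniquely, entry by entry. -/
theorem HasLinRes.of_injective (f : S →ₐ[K] R) (hf : Function.Injective f)
    (hf' : ∀ i r, r ∈ 𝒞 i ↔ ∃ s ∈ 𝒮 i, f s = r)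
    {M : Type u} {N : Type v} [AddCommGroup M] [AddCommGroup N] [Module K M] [Module K N]
    [Module S M] [Module R N] [IsScalarTower K S M] {𝓧 : ℕ → Submodule K M}
    {𝓨 : ℕ → Submodule K N} (h𝓧 : IsGradedFamily 𝒮 𝓧) (φ : M →+ N)
    (hφ : ∀ s m, φ (s • m) = f s • φ m) (hφ0 : ∀ i x, x ∈ 𝓧 i → φ x = 0 → x = 0)
    (hφ' : ∀ i y, y ∈ 𝓨 i ↔ ∃ x ∈ 𝓧 i, φ x = y) (h : HasLinRes 𝒞 𝓨) : HasLinRes 𝒮 𝓧 := by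
  refine HasLinRes.coinduct (fun M _ _ _ _ 𝓧 => IsGradedFamily 𝒮 𝓧 ∧
    ∃ (N : Type v) (_ : AddCommGroup N) (_ : Module K N) (_ : Module R N) (𝓨 : ℕ → Submodule K N)
      (φ : M →+ N), (∀ s m, φ (s • m) = f s • φ m) ∧ (∀ i x, x ∈ 𝓧 i → φ x = 0 → x = 0) ∧
      (∀ i y, y ∈ 𝓨 i ↔ ∃ x ∈ 𝓧 i, φ x = y) ∧ HasLinRes 𝒞 𝓨) ?_
    ⟨h𝓧, N, inferInstance, inferInstance, inferInstance, 𝓨, φ, hφ, hφ0, hφ', h⟩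
  rintro M _ _ _ _ 𝓧 ⟨h𝓧, N, _, _, _, 𝓨, φ, hφ, hφ0, hφ', h⟩
  obtain ⟨ι, _, e, he, h⟩ := h.exists_minGen
  choose e' he' hee using fun j => (hφ' 0 _).1 (he.mem j)
  have hcomb : ∀ v : ι → S, φ (Fintype.linearCombination S e' v) =
      Fintype.linearCombination R e (f ∘ v) := fun v => by
    simp [Fintype.linearCombination_apply, hφ, hee]
  have hmem : ∀ {i} {v : ι → S}, v ∈ KoszulAlg.vec 𝒮 ι i →
      Fintype.linearCombination S e' v ∈ 𝓧 i := fun hv => by simpa using comb_mem h𝓧 he' hv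
  have hvec : ∀ {i} {w : ι → R}, w ∈ KoszulAlg.vec 𝒞 ι i ↔
      ∃ v ∈ KoszulAlg.vec 𝒮 ι i, f ∘ v = w := by
    intro i w
    constructor
    · intro hw
      choose v hv hvw using fun j => (hf' i _).1 (mem_vec.1 hw j)
      exact ⟨v, mem_vec.2 hv, funext hvw⟩
    · rintro ⟨v, hv, rfl⟩
      exact mem_vec.2 fun j => (hf' i _).2 ⟨v j, mem_vec.1 hv j, rfl⟩
  have hinj : ∀ v : ι → S, f ∘ v = 0 → v = 0 := fun v hv =>
    funext fun j => (map_eq_zero_iff f hf).1 (congrFun hv j)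
  refine ⟨ι, inferInstance, e', ⟨fun i m => ⟨fun hm => ?_, ?_⟩, fun v hv hv0 => ?_⟩,
    isGradedFamily_syz e', ι → R, inferInstance, inferInstance, inferInstance, syz 𝒞 e,
    (f : S →+ R).compLeft ι, fun s m => ?_, fun i x _ hx => hinj x hx, fun i y => ?_, h⟩
  · obtain ⟨w, hw, hwm⟩ := (he.mem_iff i _).1 ((hφ' i _).2 ⟨m, hm, rfl⟩)
    obtain ⟨v, hv, rfl⟩ := hvec.1 hw
    refine ⟨v, hv, ?_⟩
    rw [← sub_eq_zero]
    exact hφ0 i _ (sub_mem (hmem hv) hm) (by rw [map_sub, hcomb, hwm, sub_self])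
  · rintro ⟨v, hv, rfl⟩
    exact hmem hv
  · refine hinj v (he.eq_zero _ (hvec.2 ⟨v, hv, rfl⟩) ?_)
    rw [← hcomb, hv0, map_zero]
  · ext j
    exact map_mul f s (m j)
  · rw [mem_syz, hvec]
    constructor
    · rintro ⟨⟨v, hv, rfl⟩, hv0⟩
      rw [← hcomb] at hv0
      exact ⟨v, mem_syz.2 ⟨hv, hφ0 _ _ (hmem hv) hv0⟩, rfl⟩
    · rintro ⟨v, hv, rfl⟩
      rw [mem_syz] at hv
      refine ⟨⟨v, hv.1, rfl⟩, ?_⟩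
      exact (hcomb v).symm.trans (by rw [hv.2, map_zero])

end Transport

/-! ### Standard gradings and the criterion for Koszulness -/

section Standard

variable {K A : Type*} [Field K] [CommRing A] [Algebra K A] {𝒜 : ℕ → Submodule K A}

theorem IsStandardGraded.eq_pow (h : IsStandardGraded 𝒜) (i : ℕ) : 𝒜 i = 𝒜 1 ^ i := by
  obtain ⟨n, φ, -, hφ⟩ := h.presentation
  rw [hφ, hφ, ← MvPolynomial.homogeneousSubmodule_one_pow, Submodule.map_pow]

theorem IsStandardGraded.fg_one (h : IsStandardGraded 𝒜) : (𝒜 1).FG := by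
  obtain ⟨n, φ, -, hφ⟩ := h.presentation
  rw [hφ, MvPolynomial.homogeneousSubmodule_one_eq_span_X]
  exact (Submodule.fg_span (Set.finite_range _)).map _

theorem exists_algebraMap_of_eq_pow (h : ∀ i, 𝒜 i = 𝒜 1 ^ i) :
    ∀ a ∈ 𝒜 0, ∃ c : K, algebraMap K A c = a := by
  intro a ha
  rwa [h 0, pow_zero, Submodule.mem_one] at ha

/-- A basis-free form of the presentation: finitely many generators of the degree `1` piece define a
map from a polynomial ring, and powers of that piece match powers of the space of linear forms. -/
theorem IsStandardGraded.of_eq_pow [Nontrivial A] (hint : DirectSum.IsInternal 𝒜)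
    (hfg : (𝒜 1).FG) (hpow : ∀ i, 𝒜 i = 𝒜 1 ^ i) : IsStandardGraded 𝒜 := by
  obtain ⟨n, x, hx⟩ := Submodule.fg_iff_exists_fin_generating_family.1 hfg
  have h1 : 𝒜 1 = (MvPolynomial.homogeneousSubmodule (Fin n) K 1).map
      (MvPolynomial.aeval x).toLinearMap := by
    rw [MvPolynomial.homogeneousSubmodule_one_eq_span_X, Submodule.map_span, ← Set.range_comp,
      ← hx]
    congr 2
    ext1 j
    simp
  have h : ∀ i, 𝒜 i = (MvPolynomial.homogeneousSubmodule (Fin n) K i).map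
      (MvPolynomial.aeval x).toLinearMap := fun i => by
    rw [hpow i, h1, ← Submodule.map_pow, MvPolynomial.homogeneousSubmodule_one_pow]
  refine ⟨inferInstance, hint, n, MvPolynomial.aeval x, ?_, h⟩
  have htop : LinearMap.range (MvPolynomial.aeval (R := K) x).toLinearMap = ⊤ := by
    rw [eq_top_iff, ← hint.submodule_iSup_eq_top]
    refine iSup_le fun i => ?_
    rw [h i]
    exact LinearMap.map_le_range
  exact LinearMap.range_eq_top.1 htop

/-- The graded algebra structure of a positively graded algebra. -/
abbrev IsStandardGraded.gradedAlgebra [SetLike.GradedMonoid 𝒜] (h : IsStandardGraded 𝒜) :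
    GradedAlgebra 𝒜 :=
  { toGradedMonoid := inferInstance
    toDecomposition := h.isInternal.chooseDecomposition }

theorem IsKoszul.hasLinRes_residueGrading [GradedAlgebra 𝒜] (h : IsKoszul 𝒜) :
    HasLinRes 𝒜 (residueGrading 𝒜) :=
  h.linear.elim fun L => L.hasLinRes

theorem residueGrading_succ (n : ℕ) : residueGrading 𝒜 (n + 1) = ⊥ := by
  simp [residueGrading]

theorem IsKoszul.hasLinRes [GradedAlgebra 𝒜] (h : IsKoszul 𝒜) :
    HasLinRes 𝒜 fun n => 𝒜 (n + 1) :=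
  h.hasLinRes_residueGrading.augmentationIdeal (isMinGen_residue_one 𝒜 Unit) residueGrading_succ

theorem IsKoszul.of_hasLinRes [SetLike.GradedMonoid 𝒜] (hs : IsStandardGraded 𝒜)
    (h : HasLinRes 𝒜 fun n => 𝒜 (n + 1)) : IsKoszul 𝒜 := by
  let _ := hs.gradedAlgebra
  exact ⟨hs, (HasLinRes.of_augmentationIdeal (isMinGen_residue_one 𝒜 Unit)
    residueGrading_succ h).nonempty_linearFreeResolution⟩

end Standard

/-! ### Graded subalgebras generated in degree one -/

section SumSubalgebra

variable {K R : Type*} [Field K] [CommRing R] [Algebra K R] {𝒞 : ℕ → Submodule K R}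
  [SetLike.GradedMonoid 𝒞]

theorem mem_iff_sumGrading (i : ℕ) (r : R) :
    r ∈ 𝒞 i ↔ ∃ s ∈ sumGrading 𝒞 i, (sumSubalgebra 𝒞).val s = r := by
  constructor
  · intro hr
    exact ⟨⟨r, Submodule.mem_iSup_of_mem i hr⟩, hr, rfl⟩
  · rintro ⟨s, hs, rfl⟩
    exact hs

theorem map_sumGrading (i : ℕ) :
    (sumGrading 𝒞 i).map (sumSubalgebra 𝒞).val.toLinearMap = 𝒞 i := by
  ext r
  rw [mem_iff_sumGrading]; rfl

instance : SetLike.GradedMonoid (sumGrading 𝒞) where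
  one_mem := SetLike.GradedOne.one_mem (A := 𝒞)
  mul_mem _ _ _ _ hx hy := SetLike.GradedMul.mul_mem (A := 𝒞) hx hy

theorem isStandardGraded_sumGrading [Nontrivial R] (hind : iSupIndep 𝒞) (hfg : (𝒞 1).FG)
    (hpow : ∀ i, 𝒞 i = 𝒞 1 ^ i) : IsStandardGraded (sumGrading 𝒞) := by
  have hinj : Function.Injective (sumSubalgebra 𝒞).val.toLinearMap := Subtype.val_injective
  refine IsStandardGraded.of_eq_pow
    (DirectSum.isInternal_submodule_of_iSupIndep_of_iSup_eq_top ?_ ?_) ?_ fun i => ?_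
  · rw [iSupIndep_iff_finsetSum_eq_zero_imp_eq_zero] at hind ⊢
    intro s v hv hv0 i hi
    refine hinj (hind s (fun i => v i) (fun i hi => hv i hi) ?_ i hi)
    simpa using congrArg Subtype.val hv0
  · refine Submodule.map_injective_of_injective hinj ?_
    rw [Submodule.map_iSup, Submodule.map_top]
    simp_rw [map_sumGrading]
    ext r
    exact ⟨fun hr => ⟨⟨r, hr⟩, rfl⟩, by rintro ⟨s, rfl⟩; exact s.2⟩
  · refine Submodule.fg_of_fg_map_injective _ hinj ?_
    rwa [map_sumGrading]
  · refine Submodule.map_injective_of_injective hinj ?_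
    rw [Submodule.map_pow, map_sumGrading, map_sumGrading, ← hpow]

theorem isKoszul_sumGrading [Nontrivial R] (hind : iSupIndep 𝒞) (hfg : (𝒞 1).FG)
    (hpow : ∀ i, 𝒞 i = 𝒞 1 ^ i) (h : HasLinRes 𝒞 fun n => 𝒞 (n + 1)) :
    IsKoszul (sumGrading 𝒞) :=
  IsKoszul.of_hasLinRes (isStandardGraded_sumGrading hind hfg hpow)
    (HasLinRes.of_injective (sumSubalgebra 𝒞).val Subtype.val_injective mem_iff_sumGrading
      (isGradedFamily_self.shift 1) ((sumSubalgebra 𝒞).val : _ →+ R) (fun _ _ => rfl)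
      (fun _ _ _ hx => Subtype.ext hx) (fun i => mem_iff_sumGrading (i + 1)) h)

end SumSubalgebra

/-! ### Standard gradedness of tensor and Segre products -/

section TensorStandard

variable {K A B : Type*} [Field K] [CommRing A] [CommRing B] [Algebra K A] [Algebra K B]
  {𝒜 : ℕ → Submodule K A} {ℬ : ℕ → Submodule K B}

theorem tens_eq_mul (U : Submodule K A) (V : Submodule K B) :
    tens U V = U.map (Algebra.TensorProduct.includeLeft : A →ₐ[K] A ⊗[K] B).toLinearMap *
      V.map (Algebra.TensorProduct.includeRight : B →ₐ[K] A ⊗[K] B).toLinearMap := by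
  refine le_antisymm (tens_le.2 fun a ha b hb => ?_) (Submodule.mul_le.2 ?_)
  · have := Submodule.mul_mem_mul (Submodule.mem_map_of_mem
      (f := (Algebra.TensorProduct.includeLeft : A →ₐ[K] A ⊗[K] B).toLinearMap) ha)
      (Submodule.mem_map_of_mem
      (f := (Algebra.TensorProduct.includeRight : B →ₐ[K] A ⊗[K] B).toLinearMap) hb)
    simpa using this
  · rintro _ ⟨a, ha, rfl⟩ _ ⟨b, hb, rfl⟩
    simpa using tmul_mem_tens ha hb

theorem submodule_mul_pow {R : Type*} [CommRing R] [Algebra K R] (U V : Submodule K R) (n : ℕ) :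
    (U * V) ^ n = U ^ n * V ^ n :=
  mul_pow U V n

/-- Binomial expansion for subspaces; it shows that the total grading on `A ⊗ B` is generated by `A₁
⊗ 1 + 1 ⊗ B₁`. -/
theorem sup_pow_eq_biSup {R : Type*} [CommRing R] [Algebra K R] (U V : Submodule K R) (n : ℕ) :
    (U ⊔ V) ^ n = ⨆ p ∈ {p : ℕ × ℕ | p.1 + p.2 = n}, U ^ p.1 * V ^ p.2 := by
  refine le_antisymm ?_ (iSup₂_le fun p hp => ?_)
  · induction n with
    | zero => exact le_iSup₂_of_le (0, 0) rfl (by simp)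
    | succ n ih =>
      rw [pow_succ]
      refine (mul_le_mul_left ih _).trans ?_
      rw [Submodule.iSup_mul]
      refine iSup_le fun p => ?_
      rw [Submodule.iSup_mul]
      refine iSup_le fun hp => ?_
      rw [Submodule.mul_sup]
      have hp : p.1 + p.2 = n := hp
      refine sup_le ?_ ?_
      · refine le_iSup₂_of_le (p.1 + 1, p.2) (show p.1 + 1 + p.2 = n + 1 by lia) (le_of_eq ?_)
        ring
      · refine le_iSup₂_of_le (p.1, p.2 + 1) (show p.1 + (p.2 + 1) = n + 1 by lia) (le_of_eq ?_)
        ring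
  · have hp : p.1 + p.2 = n := hp
    rw [← hp, pow_add]
    exact mul_le_mul' (pow_le_pow_left' le_sup_left _) (pow_le_pow_left' le_sup_right _)

theorem tensorGrading_eq (𝒜 : ℕ → Submodule K A) (ℬ : ℕ → Submodule K B) :
    tensorGrading 𝒜 ℬ = fun n => tfam {p | p.1 + p.2 = n} 𝒜 ℬ := by
  ext1 n
  simp only [tensorGrading, totalGrading, tensorBigrading, range_map_subtype]
  rfl

theorem diagonalComponent_eq (𝒜 : ℕ → Submodule K A) (ℬ : ℕ → Submodule K B) :
    diagonalComponent (tensorBigrading 𝒜 ℬ) 1 1 = fun n => tfam {(n, n)} 𝒜 ℬ := by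
  ext1 n
  simp [diagonalComponent, tensorBigrading, range_map_subtype, tfam]

theorem tfam_total_eq_pow (h𝒜 : ∀ i, 𝒜 i = 𝒜 1 ^ i) (hℬ : ∀ i, ℬ i = ℬ 1 ^ i) (n : ℕ) :
    tfam {p | p.1 + p.2 = n} 𝒜 ℬ =
      ((𝒜 1).map (Algebra.TensorProduct.includeLeft : A →ₐ[K] A ⊗[K] B).toLinearMap ⊔
        (ℬ 1).map (Algebra.TensorProduct.includeRight : B →ₐ[K] A ⊗[K] B).toLinearMap) ^ n := by
  rw [sup_pow_eq_biSup]
  refine iSup_congr fun p => iSup_congr fun _ => ?_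
  rw [tens_eq_mul, h𝒜, hℬ, Submodule.map_pow, Submodule.map_pow]

theorem iSupIndep_tfam (h𝒜 : iSupIndep 𝒜) (hℬ : iSupIndep ℬ) {I : ℕ → Set (ℕ × ℕ)}
    (hI : ∀ m n, m ≠ n → Disjoint (I m) (I n)) : iSupIndep fun n => tfam (I n) 𝒜 ℬ := by
  intro n
  refine ((iSupIndep_tens h𝒜 hℬ).disjoint_biSup_biSup (s := I n) (t := ⋃ (m) (_ : m ≠ n), I m)
    ?_).mono_right (iSup₂_le fun m hm => ?_)
  · simp only [Set.disjoint_iUnion_right]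
    exact fun m hm => hI n m hm.symm
  · exact biSup_mono fun p hp => Set.mem_biUnion (show m ∈ {m | m ≠ n} from hm) hp

theorem iSup_tfam_total (h𝒜 : ⨆ i, 𝒜 i = ⊤) (hℬ : ⨆ i, ℬ i = ⊤) :
    ⨆ n, tfam {p | p.1 + p.2 = n} 𝒜 ℬ = ⊤ := by
  rw [eq_top_iff, ← TensorProduct.map₂_mk_top_top_eq_top, ← h𝒜, ← hℬ, Submodule.map₂_iSup_left]
  refine iSup_le fun i => ?_
  rw [Submodule.map₂_iSup_right]
  exact iSup_le fun j => le_iSup_of_le (i + j) (le_iSup₂_of_le (i, j) rfl le_rfl)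

end TensorStandard

/-! ### The three constructions -/

section Main

variable {K : Type w} {A : Type u} {B : Type v} [Field K] [CommRing A] [CommRing B] [Algebra K A]
  [Algebra K B] {𝒜 : ℕ → Submodule K A} {ℬ : ℕ → Submodule K B} [GradedAlgebra 𝒜] [GradedAlgebra ℬ]

theorem iSupIndep_grading (𝒜 : ℕ → Submodule K A) [GradedAlgebra 𝒜] : iSupIndep 𝒜 :=
  (DirectSum.Decomposition.isInternal 𝒜).submodule_iSupIndep

section Augmentation

attribute [local instance] tensorModule isScalarTower_tensorModule

/-- The product of the two residue fields is generated by `1 ⊗ 1` and lives only in bidegree `(0,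
0)`, so its first syzygies are the augmentation ideal of the combined grading. -/
theorem HasLinRes.augmentationIdeal_tfam {I : ℕ → Set (ℕ × ℕ)} (hI0 : I 0 = {(0, 0)})
    (hI : ∀ n, (0, 0) ∉ I (n + 1)) [SetLike.GradedMonoid fun n => tfam (I n) 𝒜 ℬ]
    (h : HasLinRes (fun n => tfam (I n) 𝒜 ℬ)
      fun n => tfam (I n) (residueGrading 𝒜) (residueGrading ℬ)) :
    HasLinRes (fun n => tfam (I n) 𝒜 ℬ) fun n => tfam (I (n + 1)) 𝒜 ℬ := by
  let _ : Unique (Unit × Unit) := Unique.mk' _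
  refine h.augmentationIdeal
    ((isMinGen_residue_one 𝒜 Unit).tmul hI0 (isMinGen_residue_one ℬ Unit)) fun n => ?_
  rw [eq_bot_iff, tfam_le]
  rintro ⟨_ | i, _ | j⟩ hp x hx y hy
  · exact absurd hp (hI n)
  · rw [residueGrading_succ, Submodule.mem_bot] at hy
    simp [hy]
  · rw [residueGrading_succ, Submodule.mem_bot] at hx
    simp [hx]
  · rw [residueGrading_succ, Submodule.mem_bot] at hx
    simp [hx]

end Augmentation

theorem IsKoszul.tensor (hA : IsKoszul 𝒜) (hB : IsKoszul ℬ) : IsKoszul (tensorGrading 𝒜 ℬ) := by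
  have := hA.isStandardGraded.nontrivial
  have := hB.isStandardGraded.nontrivial
  have hpA := hA.isStandardGraded.eq_pow
  have hpB := hB.isStandardGraded.eq_pow
  rw [tensorGrading_eq]
  have : SetLike.GradedMonoid fun n => tfam {p : ℕ × ℕ | p.1 + p.2 = n} 𝒜 ℬ :=
    gradedMonoid_tfam (I := fun n => {p : ℕ × ℕ | p.1 + p.2 = n}) rfl (by
      rintro _ _ ⟨i, j⟩ ⟨i', j'⟩ rfl rfl
      simp; ring)
  refine IsKoszul.of_hasLinRes (IsStandardGraded.of_eq_pow
    (DirectSum.isInternal_submodule_of_iSupIndep_of_iSup_eq_top ?_ ?_) ?_ fun n => ?_) ?_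
  · refine iSupIndep_tfam (iSupIndep_grading 𝒜) (iSupIndep_grading ℬ) fun m n hmn => ?_
    rw [Set.disjoint_left]
    rintro p rfl h
    exact hmn h
  · exact iSup_tfam_total (DirectSum.Decomposition.isInternal 𝒜).submodule_iSup_eq_top
      (DirectSum.Decomposition.isInternal ℬ).submodule_iSup_eq_top
  · rw [tfam_total_eq_pow hpA hpB, pow_one]
    exact (hA.isStandardGraded.fg_one.map _).sup (hB.isStandardGraded.fg_one.map _)
  · rw [tfam_total_eq_pow hpA hpB, tfam_total_eq_pow hpA hpB, pow_one]
  · refine HasLinRes.augmentationIdeal_tfam (I := fun n => {p : ℕ × ℕ | p.1 + p.2 = n}) ?_ ?_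
      (HasLinRes.totalTensor (iSupIndep_grading 𝒜) (iSupIndep_grading ℬ)
        hA.hasLinRes_residueGrading hB.hasLinRes_residueGrading (iSupIndep_residueGrading 𝒜)
        (iSupIndep_residueGrading ℬ))
    · ext ⟨i, j⟩; simp
    · intro n; simp

theorem IsKoszul.segre (hA : IsKoszul 𝒜) (hB : IsKoszul ℬ) : IsKoszul (segreGrading 𝒜 ℬ) := by
  have := hA.isStandardGraded.nontrivial
  have := hB.isStandardGraded.nontrivial
  have hpA := hA.isStandardGraded.eq_pow
  have hpB := hB.isStandardGraded.eq_pow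
  have hpow : ∀ n, diagonalComponent (tensorBigrading 𝒜 ℬ) 1 1 n = tens (𝒜 1) (ℬ 1) ^ n :=
    fun n => by
      simp only [diagonalComponent_eq, tfam, Set.mem_singleton_iff, iSup_iSup_eq_left]
      rw [hpA, hpB, tens_eq_mul, tens_eq_mul, submodule_mul_pow, Submodule.map_pow,
        Submodule.map_pow]
  have hgm : SetLike.GradedMonoid fun n => tfam {(n, n)} 𝒜 ℬ := by
    rw [← diagonalComponent_eq]
    infer_instance
  refine isKoszul_sumGrading ?_ ?_ ?_ ?_
  · rw [diagonalComponent_eq]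
    exact iSupIndep_tfam (iSupIndep_grading 𝒜) (iSupIndep_grading ℬ) fun m n hmn => by simpa using hmn
  · rw [hpow, pow_one, tens_eq_mul]
    exact (hA.isStandardGraded.fg_one.map _).mul (hB.isStandardGraded.fg_one.map _)
  · intro n
    rw [hpow, hpow, pow_one]
  · rw [diagonalComponent_eq]
    exact HasLinRes.augmentationIdeal_tfam (I := fun n => {(n, n)}) rfl (by simp)
      (HasLinRes.diagonalTensor (iSupIndep_grading 𝒜) (iSupIndep_grading ℬ)
        (exists_algebraMap_of_eq_pow hpA) hA.hasLinRes (exists_algebraMap_of_eq_pow hpB)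
        hB.hasLinRes hA.hasLinRes_residueGrading hB.hasLinRes_residueGrading
        (iSupIndep_residueGrading 𝒜) (iSupIndep_residueGrading ℬ))

theorem IsKoszul.veronese (hA : IsKoszul 𝒜) {d : ℕ} (hd : 1 ≤ d) :
    IsKoszul (veroneseGrading 𝒜 d) := by
  have := hA.isStandardGraded.nontrivial
  have hpA := hA.isStandardGraded.eq_pow
  have hpow : ∀ n, veroneseComponent 𝒜 d n = (𝒜 1 ^ d) ^ n := fun n => by
    rw [← pow_mul, mul_comm, ← hpA]
    rfl
  refine isKoszul_sumGrading ?_ ?_ ?_ ?_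
  · exact (iSupIndep_grading 𝒜).comp (mul_left_injective₀ (by lia : d ≠ 0))
  · rw [hpow, pow_one]
    exact hA.isStandardGraded.fg_one.pow d
  · intro n
    rw [hpow, hpow, pow_one]
  · have h0 := exists_algebraMap_of_eq_pow hpA
    -- The augmentation ideal of the Veronese ring, with pieces `𝒜 ((n + 1) * d)`, is the Veronese
    -- family of the maximal ideal of `A` truncated by a further `d - 1` degrees.
    convert HasLinRes.veronese h0 hA.hasLinRes hd
      (HasLinRes.shift h0 hA.hasLinRes hA.hasLinRes (d - 1)) using 2 with n
    have : n * d + (d - 1) + 1 = (n + 1) * d := by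
      rw [add_assoc, Nat.sub_add_cancel hd]; ring
    rw [this]
    rfl

end Main

end KoszulAlg

end

theorem mainTheorem10 {K A B : Type*} [Field K]
    [CommRing A] [Algebra K A] (𝒜 : ℕ → Submodule K A) [GradedAlgebra 𝒜]
    [CommRing B] [Algebra K B] (ℬ : ℕ → Submodule K B) [GradedAlgebra ℬ]
    (hA : KoszulAlg.IsKoszul 𝒜) (hB : KoszulAlg.IsKoszul ℬ) :
    KoszulAlg.IsKoszul (KoszulAlg.tensorGrading 𝒜 ℬ) ∧
    KoszulAlg.IsKoszul (KoszulAlg.segreGrading 𝒜 ℬ) ∧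
    ∀ d : ℕ, 1 ≤ d → KoszulAlg.IsKoszul (KoszulAlg.veroneseGrading 𝒜 d) :=
  ⟨hA.tensor hB, hA.segre hB, fun _ hd => hA.veronese hd⟩
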